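/- Let $m\in\mathbb N$ and let $P_T$ be a $C^1$ map from $\mathbb R^m$ to the orthogonal projections of $\mathbb R^m$ ($m\times m$ matrices); put $P_N=I_m-P_T$. On $S^1=\mathbb R/2\pi\mathbb Z$ let $H^s(S^1,\mathbb R^m)$ be the Sobolev space of distributions $f=\sum_n f_ne^{in\theta}$ with $\|f\|_{H^s}^2=\sum_n(1+n^2)^s|f_n|^2<\infty$, and set $(-\Delta)^{1/4}f=\sum_n|n|^{1/2}f_ne^{in\theta}$, $(-\Delta)_0^{-1/4}f=\sum_{n\ne0}|n|^{-1/2}f_ne^{in\theta}$. For a matrix field $M$ with entries in $L^\infty\cap H^{1/2}(S^1)$ and $f\in H^{-1/2}(S^1,\mathbb R^m)$, the product $Mf$ is the distribution with $n$-th Fourier coefficient $\sum_kM_{n-k}f_k$, and $(M,f)_{H^{1/2},H^{-1/2}}=2\pi\,(Mf)_0\in\mathbb R^m$ is its total integral. (Below, $P_T(u)\in H^{1/2}$ is understood wherever such a product is formed with $u\in H^{1/2}$; it is automatic if $dP_T$ is bounded.) Let $\mathfrak H^{1/2}$ be the set of horizontal maps: $u\in H^{1/2}(S^1,\mathbb R^m)$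 with $P_N(u)\frac{du}{d\theta}=0$ as a distribution. Let $\mathfrak E$ be the set of pairs $(u,\xi)\in H^{1/2}(S^1,\mathbb R^m)\times H^{-1/2}(S^1,\mathbb R^m)$ such that $$\Big(P_N(u),\tfrac{du}{d\theta}\Big)_{H^{1/2},H^{-1/2}}=0,\qquad (-\Delta)_0^{-1/4}(P_T(u)\xi)\in L^2,\qquad (-\Delta)_0^{-1/4}\Big(P_T(u)\tfrac{du}{d\theta}\Big)\in L^2,$$ and for $(u,\xi)\in\mathfrak E$ let $$\mathcal L^{1/2}(u,\xi)=\int_{S^1}\tfrac12\big|(-\Delta)_0^{-1/4}(P_T(u)\xi)\big|^2-\Big\langle(-\Delta)_0^{-1/4}(P_T(u)\xi),(-\Delta)_0^{-1/4}\big(P_T(u)\tfrac{du}{d\theta}\big)\Big\rangle-\Big\langle(-\Delta)_0^{-1/4}(P_N(u)\xi),(-\Delta)_0^{-1/4}\big(P_N(u)\tfrac{du}{d\theta}\big)\Big\rangle\,d\theta .$$ A $C^1$ curve in $\mathfrak E$ is a map $t\mapsto(u_t,\xi_t)\in\mathfrak E$, $t\in(-1,1)$, such that $u_t$, $\xi_t$,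 $(-\Delta)_0^{-1/4}(P_T(u_t)\xi_t)$, $(-\Delta)_0^{-1/4}(P_T(u_t)\frac{du_t}{d\theta})$ are $C^1$ in $t$ with values in $H^{1/2}$, $H^{-1/2}$, $L^2$, $L^2$ respectively. A point $(u,\xi)\in\mathfrak E$ is a critical point of $\mathcal L^{1/2}$ in $\mathfrak E$ if $\frac{d}{dt}\mathcal L^{1/2}(u_t,\xi_t)\big|_{t=0}=0$ for every $C^1$ curve in $\mathfrak E$ with $(u_0,\xi_0)=(u,\xi)$. A smooth $u$ is a non-degenerate point of the constraint if the linear map $$C^\infty(S^1,\mathbb R^m)\to\mathbb R^m,\qquad w\mapsto\int_{S^1}P_N(u)\frac{dw}{d\theta}+(d_wP_N)(u)\frac{du}{d\theta}\,d\theta$$ is surjective. **Theorem.** Let $u,\xi\in C^\infty(S^1,\mathbb R^m)$ be such that $(u,\xi)$ is a critical point of $\mathcal L^{1/2}$ in $\mathfrak E$ and $u$ is a non-degenerate point of the constraint. Then $u$ is horizontal, $u\in\mathfrak H^{1/2}$. Moreover $u$ is variational $1/2$-harmonic, i.e. a critical point of $E^{1/2}(u)=\int_{S^1}|(-\Delta)^{1/4}u|^2\,d\theta$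 in $\mathfrak H^{1/2}$: for every $C^1$ curve $t\mapsto u_t$, $t\in(-1,1)$, in $H^{1/2}(S^1,\mathbb R^m)$ with $u_t\in\mathfrak H^{1/2}$ for all $t$ and $u_0=u$, one has $\frac{d}{dt}E^{1/2}(u_t)\big|_{t=0}=0$. -/

import Mathlib

open Set MeasureTheory
open scoped Real ContDiff Matrix ComplexConjugate

noncomputable section

namespace HalfHarmonic

instance instFactTwoPi : Fact (0 < 2 * π) := ⟨Real.two_pi_pos⟩

/-- The circle `S¹ = ℝ / 2πℤ`. -/
abbrev Circ : Type := AddCircle (2 * π)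

/-- The target `ℝᵐ` with its Euclidean structure. -/
abbrev Vec (m : ℕ) : Type := EuclideanSpace ℝ (Fin m)

/-- The complexification of `ℝᵐ`, in which Fourier coefficients live. -/
abbrev CVec (m : ℕ) : Type := EuclideanSpace ℂ (Fin m)

/-- A (formal) `ℂᵐ`-valued Fourier series `∑ₙ cₙ e^{inθ}`. An `ℝᵐ`-valued distribution on the
circle is recorded by its Fourier coefficients, which have the symmetry `IsReal` below. -/
abbrev Series (m : ℕ) : Type := ℤ → CVec m

/-- The square summable sequences, i.e. the Fourier coefficients of `L²(S¹, ℂᵐ)`. -/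
abbrev SqSummable (m : ℕ) : Type := lp (fun _ : ℤ => CVec m) 2

variable {m : ℕ}

/-! ### Plane distributions -/

/-- `PT` is a `C¹` field of orthogonal projections of `ℝᵐ` (a `C¹` plane distribution): with
`PN = 1 - PT`, one has `PT ∘ PT = PT` (hence `PN ∘ PN = PN`) and `⟨PT U, PN V⟩ = 0`. -/
structure IsPlaneDistribution (PT : Vec m → Matrix (Fin m) (Fin m) ℝ) : Prop where
  contDiff : ∀ i j, ContDiff ℝ 1 (fun z => PT z i j)
  idem : ∀ z, PT z * PT z = PT z
  orth : ∀ z (U V : Fin m → ℝ), (PT z *ᵥ U) ⬝ᵥ ((1 - PT z) *ᵥ V) = 0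

/-- The complementary field of projections `PN = 1 - PT`. -/
def normalProj (PT : Vec m → Matrix (Fin m) (Fin m) ℝ) (z : Vec m) : Matrix (Fin m) (Fin m) ℝ :=
  1 - PT z

/-! ### Fourier series, Sobolev spaces and operators on the circle -/

/-- Fourier coefficients `uₙ = (2π)⁻¹ ∫ u(θ) e^{-inθ} dθ` of a map `u : S¹ → ℝᵐ`. -/
def coeff (u : Circ → Vec m) : Series m := fun n =>
  WithLp.toLp 2 (fun i => fourierCoeff (fun θ : Circ => ((u θ i : ℝ) : ℂ)) n)

/-- Fourier coefficients of a field of matrices on the circle. -/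
def matCoeff (M : Circ → Matrix (Fin m) (Fin m) ℝ) (n : ℤ) : Matrix (Fin m) (Fin m) ℂ :=
  Matrix.of (fun i j => fourierCoeff (fun θ : Circ => ((M θ i j : ℝ) : ℂ)) n)

/-- The series is that of an `ℝᵐ`-valued distribution: `c₋ₙ` is the conjugate of `cₙ`. -/
def IsReal (c : Series m) : Prop := ∀ (n : ℤ) (i : Fin m), c (-n) i = conj (c n i)

/-- The sequence `(1 + n²)^{s/2} cₙ`, whose `ℓ²` norm is the `H^s` norm of `∑ₙ cₙ e^{inθ}`. -/
def bessel (s : ℝ) (c : Series m) : Series m := fun n => ((1 + (n : ℝ) ^ 2) ^ (s / 2) : ℝ) • c n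

/-- `c ∈ H^s(S¹, ℝᵐ)`, for any real `s`. -/
def MemSobolev (s : ℝ) (c : Series m) : Prop := IsReal c ∧ Memℓp (bessel s c) 2

/-- `t ↦ c t` is a `C¹` curve `(-1, 1) → H^s(S¹)`: the isometric embedding of the curve into `ℓ²`
by `bessel s` is a `C¹` curve in `ℓ²`. -/
def IsC1Curve (s : ℝ) (c : ℝ → Series m) : Prop :=
  ∃ Γ : ℝ → SqSummable m, ContDiffOn ℝ 1 Γ (Ioo (-1) 1) ∧
    ∀ t ∈ Ioo (-1 : ℝ) 1, ∀ n, Γ t n = bessel s (c t) n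

/-- The map `u` belongs to `H^{1/2}(S¹, ℝᵐ)`. -/
def MemHHalf (u : Circ → Vec m) : Prop :=
  MemLp u 2 volume ∧ MemSobolev (1 / 2) (coeff u)

/-- All columns of the field of matrices `M` belong to `H^{1/2}(S¹)`. -/
def MatMemHHalf (M : Circ → Matrix (Fin m) (Fin m) ℝ) : Prop :=
  ∀ j, MemHHalf (fun θ => WithLp.toLp 2 (fun i => M θ i j) : Circ → Vec m)

/-- The derivative `d/dθ` of a distribution. -/
def dtheta (c : Series m) : Series m := fun n => (Complex.I * (n : ℂ)) • c n

/-- The operator `(-Δ)^{α/2}`. -/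
def fracLap (α : ℝ) (c : Series m) : Series m := fun n => (|(n : ℝ)| ^ α : ℝ) • c n

/-- The operator `(-Δ)₀^{-α/2}`, which sends `∑ₙ cₙ e^{inθ}` to `∑_{n ≠ 0} |n|^{-α} cₙ e^{inθ}`. -/
def invFracLap (α : ℝ) (c : Series m) : Series m := fun n =>
  if n = 0 then 0 else (|(n : ℝ)| ^ (-α) : ℝ) • c n

/-- The product `M f` of a field of matrices `M` (with entries in `H^{1/2}`) with a distribution
`f` (in `H^{-1/2}`), as a distribution. Its `n`-th Fourier coefficient is the duality pairing
`(2π)⁻¹ (f, M e^{-inθ})` of `H^{-1/2}` and `H^{1/2}`, an absolutely convergent sum. -/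
def mulDist (M : Circ → Matrix (Fin m) (Fin m) ℝ) (f : Series m) : Series m := fun n =>
  WithLp.toLp 2 (fun i => ∑ j, ∑' k : ℤ, matCoeff M (n - k) i j * f k j)

/-- The duality product `(M, f)_{H^{1/2}, H^{-1/2}}`, i.e. the total integral of the product
`M f`. It is a vector with `m` components. -/
def pairing (M : Circ → Matrix (Fin m) (Fin m) ℝ) (f : Series m) : CVec m :=
  (2 * π : ℝ) • mulDist M f 0

/-- The integral `∫ ⟨f, g⟩ dθ` of the scalar product of two maps in `L²(S¹, ℝᵐ)`, through their
Fourier coefficients. -/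
def l2Inner (f g : Series m) : ℝ := 2 * π * ∑' n : ℤ, (∑ i, f n i * conj (g n i)).re

/-! ### Horizontal maps and the 1/2-energy -/

/-- The energy `E^{1/2}(u) = ∫ |(-Δ)^{1/4} u|² dθ`. -/
def halfEnergy (u : Circ → Vec m) : ℝ :=
  l2Inner (fracLap (1 / 2) (coeff u)) (fracLap (1 / 2) (coeff u))

/-- `u` is a horizontal `H^{1/2}` map: `PN(u) du/dθ = 0` as a distribution. (For the product to
have a meaning one needs that `PN(u)` is in `H^{1/2}`; this is automatic when the field of
projections has bounded derivatives.) -/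
structure IsHorizontal (PT : Vec m → Matrix (Fin m) (Fin m) ℝ) (u : Circ → Vec m) : Prop where
  mem : MemHHalf u
  proj_mem : MatMemHHalf (fun θ => normalProj PT (u θ))
  horizontal : mulDist (fun θ => normalProj PT (u θ)) (dtheta (coeff u)) = 0

/-- `u` is variational `1/2`-harmonic: it is a horizontal `H^{1/2}` map, and the derivative of the
energy vanishes along every `C¹` curve of horizontal `H^{1/2}` maps through `u`. -/
def IsVariationalHalfHarmonic (PT : Vec m → Matrix (Fin m) (Fin m) ℝ) (u : Circ → Vec m) : Prop :=
  IsHorizontal PT u ∧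
    ∀ v : ℝ → Circ → Vec m,
      (∀ t ∈ Ioo (-1 : ℝ) 1, IsHorizontal PT (v t)) →
      IsC1Curve (1 / 2) (fun t => coeff (v t)) →
      v 0 =ᵐ[volume] u →
      HasDerivAt (fun t => halfEnergy (v t)) 0 0

/-! ### The constrained space and the convexified Lagrangian -/

/-- The constrained space `𝔈`: pairs `(u, ξ)` in `H^{1/2} × H^{-1/2}` with
`(PN(u), du/dθ)_{H^{1/2}, H^{-1/2}} = 0`, for which `(-Δ)₀^{-1/4}(PT(u) ξ)` and
`(-Δ)₀^{-1/4}(PT(u) du/dθ)` are in `L²`. -/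
structure MemE (PT : Vec m → Matrix (Fin m) (Fin m) ℝ) (u : Circ → Vec m) (ξ : Series m) :
    Prop where
  mem_fst : MemHHalf u
  mem_snd : MemSobolev (-(1 / 2)) ξ
  proj_mem : MatMemHHalf (fun θ => PT (u θ))
  constraint : pairing (fun θ => normalProj PT (u θ)) (dtheta (coeff u)) = 0
  tangent_snd : MemSobolev 0 (invFracLap (1 / 2) (mulDist (fun θ => PT (u θ)) ξ))
  tangent_fst :
    MemSobolev 0 (invFracLap (1 / 2) (mulDist (fun θ => PT (u θ)) (dtheta (coeff u))))

/-- The Lagrangian `𝓛^{1/2}(u, ξ)`. -/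
def lagrangian (PT : Vec m → Matrix (Fin m) (Fin m) ℝ) (u : Circ → Vec m) (ξ : Series m) : ℝ :=
  l2Inner (invFracLap (1 / 2) (mulDist (fun θ => PT (u θ)) ξ))
      (invFracLap (1 / 2) (mulDist (fun θ => PT (u θ)) ξ)) / 2
    - l2Inner (invFracLap (1 / 2) (mulDist (fun θ => PT (u θ)) ξ))
        (invFracLap (1 / 2) (mulDist (fun θ => PT (u θ)) (dtheta (coeff u))))
    - l2Inner (invFracLap (1 / 2) (mulDist (fun θ => normalProj PT (u θ)) ξ))
        (invFracLap (1 / 2) (mulDist (fun θ => normalProj PT (u θ)) (dtheta (coeff u))))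

/-- `t ↦ (v t, ζ t)` is a `C¹` curve in `𝔈`, parametrized by `(-1, 1)`: it stays in `𝔈`, and all
the quantities that enter the definition of `𝔈` are `C¹` in their spaces, namely `v` in `H^{1/2}`,
`ζ` in `H^{-1/2}`, and `(-Δ)₀^{-1/4}(PT(v) ζ)`, `(-Δ)₀^{-1/4}(PT(v) dv/dθ)` in `L²`. -/
structure IsC1CurveE (PT : Vec m → Matrix (Fin m) (Fin m) ℝ) (v : ℝ → Circ → Vec m)
    (ζ : ℝ → Series m) : Prop where
  mem : ∀ t ∈ Ioo (-1 : ℝ) 1, MemE PT (v t) (ζ t)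
  fst : IsC1Curve (1 / 2) (fun t => coeff (v t))
  snd : IsC1Curve (-(1 / 2)) ζ
  tangent_snd :
    IsC1Curve 0 (fun t => invFracLap (1 / 2) (mulDist (fun θ => PT (v t θ)) (ζ t)))
  tangent_fst :
    IsC1Curve 0
      (fun t => invFracLap (1 / 2) (mulDist (fun θ => PT (v t θ)) (dtheta (coeff (v t)))))

/-- `(u, ξ)` is a critical point of `𝓛^{1/2}` in `𝔈`: it is in `𝔈`, and the derivative of the
Lagrangian vanishes along every `C¹` curve in `𝔈` through `(u, ξ)`. -/
def IsCriticalPoint (PT : Vec m → Matrix (Fin m) (Fin m) ℝ) (u : Circ → Vec m) (ξ : Series m) :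
    Prop :=
  MemE PT u ξ ∧
    ∀ (v : ℝ → Circ → Vec m) (ζ : ℝ → Series m),
      IsC1CurveE PT v ζ → v 0 =ᵐ[volume] u → ζ 0 = ξ →
      HasDerivAt (fun t => lagrangian PT (v t) (ζ t)) 0 0

/-- A map on the circle is smooth if its `2π`-periodic lift to `ℝ` is. -/
def IsSmooth (u : Circ → Vec m) : Prop := ContDiff ℝ ∞ (fun x : ℝ => u (x : Circ))

/-- The differential at a smooth map `u` of the constraint `u ↦ (PN(u), du/dθ)`, in the direction
`w`: the integral of `PN(u) dw/dθ + (d_w PN)(u) du/dθ`. -/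
def linConstraint (PT : Vec m → Matrix (Fin m) (Fin m) ℝ) (u w : Circ → Vec m) : Vec m :=
  WithLp.toLp 2 (fun i => ∫ x in (0 : ℝ)..(2 * π), ∑ j,
    (normalProj PT (u (x : Circ)) i j * deriv (fun y : ℝ => w (y : Circ) j) x
      + fderiv ℝ (fun z => normalProj PT z i j) (u (x : Circ)) (w (x : Circ))
        * deriv (fun y : ℝ => u (y : Circ) j) x))

/-- The smooth map `u` is a non-degenerate point of the constraint: the differential of the
constraint at `u` is onto `ℝᵐ`. -/
def IsNondegenerate (PT : Vec m → Matrix (Fin m) (Fin m) ℝ) (u : Circ → Vec m) : Prop :=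
  ∀ a : Vec m, ∃ w : Circ → Vec m, IsSmooth w ∧ linConstraint PT u w = a

end HalfHarmonic

end

/-! Write Λ for (-Δ)₀^{-1/4} and u' for du/dθ. With `u` fixed, the Lagrangian is a quadratic
polynomial in ξ, and stationarity in a direction η reads ⟨Λ P_T(ξ - u'), Λ P_T η⟩ = ⟨Λ P_N η, Λ P_N
u'⟩ (`inner_eq_of_isCriticalPoint`). As P_T and P_N are complementary projections, each side can be
tested alone: η = P_N u' gives Λ(P_N u') = 0, and η = P_T(ξ - u') gives Λ P_T(ξ - u') = 0. The first
says that P_N(u)u' is constant; the constraint says that its mean is zero, so `u` is horizontal.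

For the energy, a curve v_t of horizontal maps is lifted to 𝔈 by the multiplier ζ_t = v_t' + h_t,
where h_t = χ(v_t, y) y, y = ξ - u', and χ is a cutoff equal to 1 on the range of (u, y), so that
ζ_0 = ξ. Since P_N(v_t)v_t' = 0, completing the square gives 𝓛(v_t, ζ_t) = ½‖Λ P_T(v_t)h_t‖² -
½E(v_t) (`lagrangian_of_isHorizontal`). The square has zero derivative at t = 0, because Λ P_T(u)y =
0 there; so does 𝓛, by criticality; hence so does E.

The analytic point is that the lift is a C¹ curve in 𝔈. Maps in H^{1/2} need not be bounded and dP_T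
may be unbounded, which is why χ is needed: it reduces the claim to superposition with compactly
supported C¹ maps, which preserves C¹ curves in L² (`contDiffOn_superposition`). -/

noncomputable section

namespace HalfHarmonic

open Filter Topology
open scoped ENNReal

/-! ### Superposition operators along C¹ curves in L². -/

section Superposition

variable {α : Type*} [MeasurableSpace α] {μ : Measure α}
  {E : Type*} [NormedAddCommGroup E] [NormedSpace ℝ E]
  {W : Type*} [NormedAddCommGroup W]

/-- Dominated convergence in `L²`. -/
theorem tendsto_eLpNorm_two_of_dominated {ι : Type*} {l : Filter ι} [l.IsCountablyGenerated]
    {f : ι → α → W} {g : α → ℝ} (hg : MemLp g 2 μ)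
    (hf : ∀ k, AEStronglyMeasurable (f k) μ) (hfg : ∀ k, ∀ᵐ x ∂μ, ‖f k x‖ ≤ g x)
    (hlim : ∀ᵐ x ∂μ, Tendsto (fun k => f k x) l (𝓝 0)) :
    Tendsto (fun k => eLpNorm (f k) 2 μ) l (𝓝 0) := by
  have key : Tendsto (fun k => ∫⁻ x, ‖f k x‖ₑ ^ (2 : ℝ) ∂μ) l (𝓝 (∫⁻ _, 0 ∂μ)) := by
    refine tendsto_lintegral_filter_of_dominated_convergence' (fun x => ‖g x‖ₑ ^ (2 : ℝ))
      (.of_forall fun k => (hf k).enorm.pow_const _) (.of_forall fun k => ?_) ?_ ?_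
    · filter_upwards [hfg k] with x hx
      gcongr
      rw [enorm_le_iff_norm_le]
      exact hx.trans (le_abs_self _)
    · have := lintegral_rpow_enorm_lt_top_of_eLpNorm_lt_top (p := 2) (by simp) (by simp) hg.2
      simpa using this.ne
    · filter_upwards [hlim] with x hx
      have h1 : Tendsto (fun k => ‖f k x‖ₑ) l (𝓝 0) := by
        simpa using hx.enorm
      have := (ENNReal.continuous_rpow_const (y := (2 : ℝ))).tendsto 0 |>.comp h1
      simpa [Function.comp_def] using this
  have h2 := (ENNReal.continuous_rpow_const (y := (1 / 2 : ℝ))).tendsto _ |>.comp key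
  simpa [Function.comp_def, eLpNorm_eq_lintegral_rpow_enorm_toReal] using h2

theorem tendsto_Lp_of_dominated {ι : Type*} {l : Filter ι} [l.IsCountablyGenerated]
    {f : ι → Lp W 2 μ} {f₀ : Lp W 2 μ} {g : α → ℝ} (hg : MemLp g 2 μ)
    (hfg : ∀ k, ∀ᵐ x ∂μ, ‖f k x - f₀ x‖ ≤ g x)
    (hlim : ∀ᵐ x ∂μ, Tendsto (fun k => f k x) l (𝓝 (f₀ x))) :
    Tendsto f l (𝓝 f₀) := by
  rw [Lp.tendsto_Lp_iff_tendsto_eLpNorm']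
  refine tendsto_eLpNorm_two_of_dominated hg
    (fun k => (Lp.aestronglyMeasurable _).sub (Lp.aestronglyMeasurable _)) hfg ?_
  filter_upwards [hlim] with x hx
  simpa using hx.sub_const (f₀ x)

variable [NormedSpace ℝ W] {F : E → W} {C : ℝ}

theorem norm_sub_le_of_fderiv_le (hF : ContDiff ℝ 1 F) (hC : ∀ z, ‖fderiv ℝ F z‖ ≤ C) (a b : E) :
    ‖F b - F a‖ ≤ C * ‖b - a‖ :=
  convex_univ.norm_image_sub_le_of_norm_fderiv_le
    (fun x _ => (hF.differentiable one_ne_zero) x) (fun x _ => hC x) (mem_univ a) (mem_univ b)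

theorem memLp_comp_of_fderiv_le [IsFiniteMeasure μ] (hF : ContDiff ℝ 1 F)
    (hC : ∀ z, ‖fderiv ℝ F z‖ ≤ C) (f : Lp E 2 μ) : MemLp (fun x => F (f x)) 2 μ := by
  have h0 : MemLp (fun x => F (f x) - F 0) 2 μ := by
    refine MemLp.of_le_mul (c := C) (Lp.memLp f) ?_ (.of_forall fun x => ?_)
    · exact (hF.continuous.comp_aestronglyMeasurable (Lp.aestronglyMeasurable f)).sub
        aestronglyMeasurable_const
    · simpa using norm_sub_le_of_fderiv_le hF hC 0 (f x)
  simpa [Pi.add_def] using h0.add (memLp_const (F 0))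

theorem aestronglyMeasurable_fderiv_apply (hF : ContDiff ℝ 1 F) (f w : Lp E 2 μ) :
    AEStronglyMeasurable (fun x => fderiv ℝ F (f x) (w x)) μ := by
  have hc : Continuous fun p : E × E => fderiv ℝ F p.1 p.2 :=
    ((hF.continuous_fderiv one_ne_zero).comp continuous_fst).clm_apply continuous_snd
  exact hc.comp_aestronglyMeasurable
    ((Lp.aestronglyMeasurable f).prodMk (Lp.aestronglyMeasurable w))

theorem memLp_fderiv_apply (hF : ContDiff ℝ 1 F)
    (hC : ∀ z, ‖fderiv ℝ F z‖ ≤ C) (f w : Lp E 2 μ) :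
    MemLp (fun x => fderiv ℝ F (f x) (w x)) 2 μ := by
  refine MemLp.of_le_mul (c := C) (Lp.memLp w) ?_ (.of_forall fun x => ?_)
  · exact aestronglyMeasurable_fderiv_apply hF f w
  · exact (ContinuousLinearMap.le_opNorm _ _).trans (by gcongr; exact hC _)

/-- The superposition operator `f ↦ F ∘ f` on `L²`. -/
def superposition [IsFiniteMeasure μ] (hF : ContDiff ℝ 1 F) (hC : ∀ z, ‖fderiv ℝ F z‖ ≤ C)
    (f : Lp E 2 μ) : Lp W 2 μ :=
  (memLp_comp_of_fderiv_le hF hC f).toLp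

/-- The Gateaux derivative of the superposition operator. -/
def superpositionDeriv (hF : ContDiff ℝ 1 F) (hC : ∀ z, ‖fderiv ℝ F z‖ ≤ C)
    (f w : Lp E 2 μ) : Lp W 2 μ :=
  (memLp_fderiv_apply hF hC f w).toLp

theorem coeFn_superposition [IsFiniteMeasure μ] (hF : ContDiff ℝ 1 F)
    (hC : ∀ z, ‖fderiv ℝ F z‖ ≤ C) (f : Lp E 2 μ) :
    superposition hF hC f =ᵐ[μ] fun x => F (f x) := MemLp.coeFn_toLp _

theorem coeFn_superpositionDeriv (hF : ContDiff ℝ 1 F)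
    (hC : ∀ z, ‖fderiv ℝ F z‖ ≤ C) (f w : Lp E 2 μ) :
    superpositionDeriv hF hC f w =ᵐ[μ] fun x => fderiv ℝ F (f x) (w x) := MemLp.coeFn_toLp _

theorem norm_superposition_sub_le [IsFiniteMeasure μ] (hF : ContDiff ℝ 1 F)
    (hC : ∀ z, ‖fderiv ℝ F z‖ ≤ C) (f g : Lp E 2 μ) :
    ‖superposition hF hC f - superposition hF hC g‖ ≤ C * ‖f - g‖ := by
  refine Lp.norm_le_mul_norm_of_ae_le_mul ?_
  filter_upwards [Lp.coeFn_sub (superposition hF hC f) (superposition hF hC g), Lp.coeFn_sub f g,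
    coeFn_superposition hF hC f, coeFn_superposition hF hC g] with x h1 h2 h3 h4
  rw [h1, h2]
  simp only [Pi.sub_apply, h3, h4]
  exact norm_sub_le_of_fderiv_le hF hC _ _

theorem norm_superpositionDeriv_sub_le (hF : ContDiff ℝ 1 F)
    (hC : ∀ z, ‖fderiv ℝ F z‖ ≤ C) (f w w' : Lp E 2 μ) :
    ‖superpositionDeriv hF hC f w - superpositionDeriv hF hC f w'‖ ≤ C * ‖w - w'‖ := by
  refine Lp.norm_le_mul_norm_of_ae_le_mul ?_
  filter_upwards [Lp.coeFn_sub (superpositionDeriv hF hC f w) (superpositionDeriv hF hC f w'),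
    Lp.coeFn_sub w w', coeFn_superpositionDeriv hF hC f w,
    coeFn_superpositionDeriv hF hC f w'] with x h1 h2 h3 h4
  rw [h1, h2]
  simp only [Pi.sub_apply, h3, h4, ← map_sub]
  exact (ContinuousLinearMap.le_opNorm _ _).trans (by gcongr; exact hC _)

/-- Along a fixed direction the difference quotients converge pointwise and are dominated by `C * ‖w
x‖`, so dominated convergence applies. The bound is not uniform over directions, hence only a
Gateaux derivative. -/
theorem hasDerivAt_superposition_line [IsFiniteMeasure μ] (hF : ContDiff ℝ 1 F)
    (hC : ∀ z, ‖fderiv ℝ F z‖ ≤ C) (f w : Lp E 2 μ) :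
    HasDerivAt (fun h : ℝ => superposition hF hC (f + h • w)) (superpositionDeriv hF hC f w) 0 := by
  have hpt : ∀ h : ℝ, ∀ᵐ x ∂μ, (slope (fun h : ℝ => superposition hF hC (f + h • w)) 0 h :
      Lp W 2 μ) x = h⁻¹ • (F (f x + h • w x) - F (f x)) := by
    intro h
    rw [slope_def_module, sub_zero, zero_smul, add_zero]
    filter_upwards [Lp.coeFn_smul h⁻¹ (superposition hF hC (f + h • w) - superposition hF hC f),
      Lp.coeFn_sub (superposition hF hC (f + h • w)) (superposition hF hC f),
      coeFn_superposition hF hC (f + h • w), coeFn_superposition hF hC f,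
      Lp.coeFn_add f (h • w), Lp.coeFn_smul h w] with x h1 h2 h3 h4 h5 h6
    rw [h1, Pi.smul_apply, h2, Pi.sub_apply, h3, h4, h5, Pi.add_apply, h6, Pi.smul_apply]
  have hmeas : AEStronglyMeasurable (fun x => fderiv ℝ F (f x) (w x)) μ :=
    aestronglyMeasurable_fderiv_apply hF f w
  rw [hasDerivAt_iff_tendsto_slope, Lp.tendsto_Lp_iff_tendsto_eLpNorm']
  refine Tendsto.congr (f₁ := fun h : ℝ => eLpNorm (fun x => h⁻¹ • (F (f x + h • w x) - F (f x))
    - fderiv ℝ F (f x) (w x)) 2 μ) (fun h => ?_) ?_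
  · refine eLpNorm_congr_ae ?_
    filter_upwards [hpt h, coeFn_superpositionDeriv hF hC f w] with x h1 h2
    simp [h1, h2]
  · refine tendsto_eLpNorm_two_of_dominated (g := fun x => 2 * C * ‖w x‖)
      ((Lp.memLp w).norm.const_mul _) (fun h => ?_) (fun h => .of_forall fun x => ?_)
      (.of_forall fun x => ?_)
    · refine (AEStronglyMeasurable.const_smul ((hF.continuous.comp_aestronglyMeasurable ?_).sub
        (hF.continuous.comp_aestronglyMeasurable (Lp.aestronglyMeasurable f))) _).sub hmeas
      exact (Lp.aestronglyMeasurable f).add ((Lp.aestronglyMeasurable w).const_smul h)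
    · have h1 : ‖h⁻¹ • (F (f x + h • w x) - F (f x))‖ ≤ C * ‖w x‖ := by
        rw [norm_smul]
        have h2 := norm_sub_le_of_fderiv_le hF hC (f x) (f x + h • w x)
        rw [add_sub_cancel_left, norm_smul] at h2
        -- The domination is required for every `h`; at `h = 0` the quotient is zero because `0⁻¹ =
        -- 0`.
        rcases eq_or_ne h 0 with rfl | hh
        · simpa using mul_nonneg ((norm_nonneg _).trans (hC 0)) (norm_nonneg (w x))
        · calc ‖h⁻¹‖ * _ ≤ ‖h⁻¹‖ * (C * (‖h‖ * ‖w x‖)) := by gcongr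
            _ = C * ‖w x‖ := by
              rw [norm_inv]
              have : ‖h‖ ≠ 0 := norm_ne_zero_iff.2 hh
              field_simp
      have h3 : ‖fderiv ℝ F (f x) (w x)‖ ≤ C * ‖w x‖ :=
        (ContinuousLinearMap.le_opNorm _ _).trans (by gcongr; exact hC _)
      linarith [norm_sub_le (h⁻¹ • (F (f x + h • w x) - F (f x))) (fderiv ℝ F (f x) (w x))]
    · have h1 : HasDerivAt (fun h : ℝ => F (f x + h • w x)) (fderiv ℝ F (f x) (w x)) 0 := by
        have h2 : HasDerivAt (fun h : ℝ => f x + h • w x) (w x) 0 := by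
          simpa using ((hasDerivAt_id (0 : ℝ)).smul_const (w x)).const_add (f x)
        have h3 : HasFDerivAt F (fderiv ℝ F (f x)) (f x + (0 : ℝ) • w x) := by
          simpa using (hF.differentiable one_ne_zero (f x)).hasFDerivAt
        exact h3.comp_hasDerivAt 0 h2
      have h4 := (hasDerivAt_iff_tendsto_slope.1 h1).sub_const (fderiv ℝ F (f x) (w x))
      simpa [slope_fun_def] using h4

/-- The curve differs from its tangent line by `o(s - t)`, and the superposition operator is
Lipschitz, so the derivative along the line is the derivative along the curve. -/
theorem hasDerivAt_superposition [IsFiniteMeasure μ] (hF : ContDiff ℝ 1 F)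
    (hC : ∀ z, ‖fderiv ℝ F z‖ ≤ C) {Γ : ℝ → Lp E 2 μ} {w : Lp E 2 μ} {t : ℝ}
    (hΓ : HasDerivAt Γ w t) :
    HasDerivAt (fun s => superposition hF hC (Γ s)) (superpositionDeriv hF hC (Γ t) w) t := by
  have h1 : HasDerivAt (fun s : ℝ => superposition hF hC (Γ t + (s - t) • w))
      (superpositionDeriv hF hC (Γ t) w) t := by
    have h0 := hasDerivAt_superposition_line hF hC (Γ t) w
    rw [← sub_self t] at h0
    simpa [Function.comp_def] using h0.scomp_of_eq t ((hasDerivAt_id t).sub_const t) rfl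
  rw [hasDerivAt_iff_isLittleO] at h1 hΓ ⊢
  have h2 : (fun s => superposition hF hC (Γ s) - superposition hF hC (Γ t + (s - t) • w))
      =o[𝓝 t] fun s => s - t := by
    refine Asymptotics.IsBigO.trans_isLittleO (.of_bound C (.of_forall fun s => ?_)) hΓ
    rw [sub_sub]
    exact norm_superposition_sub_le hF hC _ _
  refine (h2.add h1).congr_left fun s => ?_
  simp only [sub_self, zero_smul, add_zero]
  abel

/-- Joint continuity in the base point and the direction. The direction is handled by a Lipschitz
bound uniform in the base point, which leaves the case of a fixed direction. -/
theorem tendsto_superpositionDeriv (hF : ContDiff ℝ 1 F)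
    (hC : ∀ z, ‖fderiv ℝ F z‖ ≤ C) {ι : Type*} {l : Filter ι} [l.IsCountablyGenerated]
    {f w : ι → Lp E 2 μ} {f₀ w₀ : Lp E 2 μ} (hf : Tendsto f l (𝓝 f₀)) (hw : Tendsto w l (𝓝 w₀)) :
    Tendsto (fun k => superpositionDeriv hF hC (f k) (w k)) l
      (𝓝 (superpositionDeriv hF hC f₀ w₀)) := by
  have h1 : Tendsto (fun k => superpositionDeriv hF hC (f k) w₀) l
      (𝓝 (superpositionDeriv hF hC f₀ w₀)) := by
    -- L² convergence of the base points gives a.e. convergence only along subsequences, which is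
    -- enough for dominated convergence.
    refine tendsto_of_subseq_tendsto fun x hx => ?_
    obtain ⟨φ, -, hφ⟩ := (tendstoInMeasure_of_tendsto_Lp (hf.comp hx)).exists_seq_tendsto_ae
    refine ⟨φ, tendsto_Lp_of_dominated (g := fun x => 2 * C * ‖w₀ x‖)
      ((Lp.memLp w₀).norm.const_mul _) (fun k => ?_) ?_⟩
    · filter_upwards [coeFn_superpositionDeriv hF hC (f (x (φ k))) w₀,
        coeFn_superpositionDeriv hF hC f₀ w₀] with a h1 h2
      rw [h1, h2]
      have h3 : ∀ z, ‖fderiv ℝ F z (w₀ a)‖ ≤ C * ‖w₀ a‖ := fun z =>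
        (ContinuousLinearMap.le_opNorm _ _).trans (by gcongr; exact hC _)
      refine (norm_sub_le _ _).trans ?_
      linarith [h3 (f (x (φ k)) a), h3 (f₀ a)]
    · filter_upwards [hφ, ae_all_iff.2 fun k => coeFn_superpositionDeriv hF hC (f (x (φ k))) w₀,
        coeFn_superpositionDeriv hF hC f₀ w₀] with a h1 h2 h3
      simp only [h2, h3]
      have h4 : Tendsto (fun k => fderiv ℝ F (f (x (φ k)) a)) atTop (𝓝 (fderiv ℝ F (f₀ a))) :=
        ((hF.continuous_fderiv one_ne_zero).tendsto _).comp h1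
      exact ((ContinuousLinearMap.apply ℝ W (w₀ a)).continuous.tendsto _).comp h4
  have h2 : Tendsto (fun k => superpositionDeriv hF hC (f k) (w k)
      - superpositionDeriv hF hC (f k) w₀) l (𝓝 0) := by
    refine squeeze_zero_norm (fun k => norm_superpositionDeriv_sub_le hF hC _ _ _) ?_
    have := ((hw.sub_const w₀).norm).const_mul C
    simpa using this
  simpa using h2.add h1

/-- Although the superposition operator is in general not differentiable on `L²`, it maps `C¹`
curves in `L²` to `C¹` curves in `L²`. -/
theorem contDiffOn_superposition [IsFiniteMeasure μ] (hF : ContDiff ℝ 1 F)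
    (hC : ∀ z, ‖fderiv ℝ F z‖ ≤ C) {Γ : ℝ → Lp E 2 μ} {s : Set ℝ} (hs : IsOpen s)
    (hΓ : ContDiffOn ℝ 1 Γ s) : ContDiffOn ℝ 1 (fun t => superposition hF hC (Γ t)) s := by
  rw [show (1 : WithTop ℕ∞) = 0 + 1 from rfl, contDiffOn_succ_iff_deriv_of_isOpen hs] at hΓ ⊢
  have hd : ∀ t ∈ s, HasDerivAt (fun t => superposition hF hC (Γ t))
      (superpositionDeriv hF hC (Γ t) (deriv Γ t)) t := fun t ht =>
    hasDerivAt_superposition hF hC (hΓ.1.differentiableAt (hs.mem_nhds ht)).hasDerivAt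
  refine ⟨fun t ht => (hd t ht).differentiableAt.differentiableWithinAt, by simp, ?_⟩
  have hc := hΓ.2.2
  rw [contDiffOn_zero] at hc ⊢
  intro t ht
  have h1 : Tendsto (fun r => superpositionDeriv hF hC (Γ r) (deriv Γ r)) (𝓝[s] t)
      (𝓝 (superpositionDeriv hF hC (Γ t) (deriv Γ t))) :=
    tendsto_superpositionDeriv hF hC (hΓ.1.continuousOn t ht) (hc t ht)
  rw [ContinuousWithinAt, (hd t ht).deriv]
  exact h1.congr' (eventually_nhdsWithin_of_forall fun r hr => (hd r hr).deriv.symm)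

end Superposition

variable {m : ℕ}

/-! ### Bounded diagonal operators on ℓ². -/

section Multipliers

variable {E F : Type*} [NormedAddCommGroup E] [NormedAddCommGroup F]

theorem memℓp_of_norm_le_mul {C : ℝ} {x : ℤ → E} {y : ℤ → F} (hx : Memℓp x 2)
    (h : ∀ n, ‖y n‖ ≤ C * ‖x n‖) : Memℓp y 2 := by
  have h2 : (0 : ℝ) < (2 : ℝ≥0∞).toReal := by simp
  rw [memℓp_gen_iff h2] at hx ⊢
  simp only [ENNReal.toReal_ofNat, Real.rpow_ofNat] at hx ⊢
  refine Summable.of_nonneg_of_le (fun n => by positivity) (fun n => ?_) (hx.mul_left (C ^ 2))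
  rw [← mul_pow]
  exact pow_le_pow_left₀ (norm_nonneg _) (h n) 2

variable [NormedSpace ℝ E] [NormedSpace ℝ F]

/-- The operator on `ℓ²` which acts on the `n`-th entry through `T n`, for a bounded family `T`. -/
def lpMap (T : ℤ → E →L[ℝ] F) (C : ℝ) (hT : ∀ n, ‖T n‖ ≤ C) :
    lp (fun _ : ℤ => E) 2 →L[ℝ] lp (fun _ : ℤ => F) 2 :=
  LinearMap.mkContinuous
    { toFun := fun x => ⟨fun n => T n (x n), memℓp_of_norm_le_mul (lp.memℓp x)
        fun n => (T n).le_of_opNorm_le (hT n) (x n)⟩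
      map_add' := fun x y => by ext n; exact map_add (T n) _ _
      map_smul' := fun c x => by ext n; exact map_smul (T n) _ _ }
    C (fun x => by
      have hC : 0 ≤ C := (norm_nonneg _).trans (hT 0)
      have h2 : (0 : ℝ) < (2 : ℝ≥0∞).toReal := by simp
      have hs := lp.hasSum_norm h2 x
      refine lp.norm_le_of_forall_sum_le h2 (by positivity) fun s => ?_
      rw [Real.mul_rpow hC (norm_nonneg _)]
      refine le_trans ?_ (mul_le_mul_of_nonneg_left (sum_le_hasSum s (fun n _ => by positivity) hs)
        (by positivity))
      rw [Finset.mul_sum]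
      refine Finset.sum_le_sum fun n _ => ?_
      rw [← Real.mul_rpow hC (norm_nonneg _)]
      exact Real.rpow_le_rpow (norm_nonneg _) ((T n).le_of_opNorm_le (hT n) (x n)) (by simp))

@[simp]
theorem lpMap_apply (T : ℤ → E →L[ℝ] F) (C : ℝ) (hT : ∀ n, ‖T n‖ ≤ C)
    (x : lp (fun _ : ℤ => E) 2) (n : ℤ) : lpMap T C hT x n = T n (x n) := rfl

end Multipliers

/-- The Fourier multiplier with bounded symbol `a`. -/
def diag (a : ℤ → ℂ) (ha : ∀ n, ‖a n‖ ≤ 1) : SqSummable m →L[ℝ] SqSummable m :=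
  lpMap (fun n => (a n • ContinuousLinearMap.id ℂ (CVec m)).restrictScalars ℝ) 1 (fun n => by
    refine ContinuousLinearMap.opNorm_le_bound _ zero_le_one fun x => ?_
    simpa [norm_smul] using mul_le_mul_of_nonneg_right (ha n) (norm_nonneg x))

@[simp]
theorem diag_apply (a : ℤ → ℂ) (ha : ∀ n, ‖a n‖ ≤ 1) (x : SqSummable m) (n : ℤ) :
    diag a ha x n = a n • x n := rfl

/-! ### Fourier coefficients as continuous linear maps between L² and ℓ². -/

/-- The normalised measure on the circle. -/
abbrev haar : Measure Circ := AddCircle.haarAddCircle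

theorem ae_haar_iff {p : Circ → Prop} : (∀ᵐ x ∂haar, p x) ↔ ∀ᵐ x, p x := by
  rw [AddCircle.volume_eq_smul_haarAddCircle,
    Measure.ae_ennreal_smul_measure_iff (by simpa using Real.pi_pos)]

theorem memLp_haar_iff {E : Type*} [NormedAddCommGroup E] {p : ℝ≥0∞} {f : Circ → E} :
    MemLp f p haar ↔ MemLp f p volume := by
  rw [AddCircle.volume_eq_smul_haarAddCircle]
  refine ⟨fun h => h.smul_measure ENNReal.ofReal_ne_top, fun h => ?_⟩
  have h0 : ENNReal.ofReal (2 * π) ≠ 0 := by simpa using Real.pi_pos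
  have := h.smul_measure (c := (ENNReal.ofReal (2 * π))⁻¹) (by simpa using Real.pi_pos)
  rwa [smul_smul, ENNReal.inv_mul_cancel h0 ENNReal.ofReal_ne_top, one_smul] at this

theorem coeff_congr_ae {f g : Circ → Vec m} (h : f =ᵐ[haar] g) : coeff f = coeff g := by
  funext n
  ext i
  have : (fun θ => ((f θ i : ℝ) : ℂ)) =ᵐ[haar] fun θ => ((g θ i : ℝ) : ℂ) := by
    filter_upwards [h] with x hx
    rw [hx]
  exact congrFun (fourierCoeff_congr_ae this) n

/-- The `i`-th coordinate of a real vector, as a complex number. -/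
def coordC (i : Fin m) : Vec m →L[ℝ] ℂ := Complex.ofRealCLM ∘L EuclideanSpace.proj i

@[simp]
theorem coordC_apply (i : Fin m) (x : Vec m) : coordC i x = ((x i : ℝ) : ℂ) := rfl

/-- The Fourier coefficients of a map in `L²`, as a continuous linear map to `ℓ²`. -/
def analysis : Lp (Vec m) 2 haar →L[ℝ] SqSummable m :=
  ∑ i, lpMap (fun _ => (ContinuousLinearMap.toSpanSingleton ℂ
      (EuclideanSpace.single i 1 : CVec m)).restrictScalars ℝ) 1 (fun _ => by simp)
    ∘L ((fourierBasis (T := 2 * π)).repr.toContinuousLinearEquiv.toContinuousLinearMap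
      |>.restrictScalars ℝ) ∘L (coordC i).compLpL 2 haar

theorem fourierBasis_repr_compLpL (f : Lp (Vec m) 2 haar) (i : Fin m) (n : ℤ) :
    (fourierBasis (T := 2 * π)).repr ((coordC i).compLpL 2 haar f) n = coeff f n i := by
  rw [fourierBasis_repr]
  exact congrFun (fourierCoeff_congr_ae ((coordC i).coeFn_compLpL f)) n

theorem analysis_apply (f : Lp (Vec m) 2 haar) (n : ℤ) : analysis f n = coeff f n := by
  have h : analysis f n = ∑ i, (EuclideanSpace.single i (coeff f n i) : CVec m) := by
    simp only [analysis, sum_apply]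
    refine ((congrFun (lp.coeFn_sum _ _) n).trans (Finset.sum_apply n _ _)).trans
      (Finset.sum_congr rfl fun i _ => ?_)
    rw [← fourierBasis_repr_compLpL]
    ext j
    by_cases hj : j = i <;> simp [hj]
  ext i
  rw [h, WithLp.ofLp_sum, Finset.sum_apply]
  simp

/-- The real part of the sum of a Fourier series in `L²`. -/
def synthesis : SqSummable m →L[ℝ] Lp (Vec m) 2 haar :=
  ∑ i, (ContinuousLinearMap.toSpanSingleton ℝ (EuclideanSpace.single i 1 : Vec m)
      ∘L Complex.reCLM).compLpL 2 haar
    ∘L ((fourierBasis (T := 2 * π)).repr.symm.toContinuousLinearEquiv.toContinuousLinearMap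
      |>.restrictScalars ℝ)
    ∘L lpMap (fun _ => (EuclideanSpace.proj i : CVec m →L[ℂ] ℂ).restrictScalars ℝ) 1 (fun _ =>
      ContinuousLinearMap.opNorm_le_bound _ zero_le_one fun x => by
        simpa using PiLp.norm_apply_le x i)

/-- Taking real parts loses nothing, as `f` is real valued. This turns a C¹ curve of coefficients
back into a C¹ curve of L² maps. -/
theorem synthesis_analysis (f : Lp (Vec m) 2 haar) : synthesis (analysis f) = f := by
  have h : ∀ i, (fourierBasis (T := 2 * π)).repr.symm
      (lpMap (fun _ => (EuclideanSpace.proj i : CVec m →L[ℂ] ℂ).restrictScalars ℝ) 1 (fun _ =>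
      ContinuousLinearMap.opNorm_le_bound _ zero_le_one fun x => by
        simpa using PiLp.norm_apply_le x i) (analysis f)) = (coordC i).compLpL 2 haar f := by
    intro i
    rw [LinearIsometryEquiv.symm_apply_eq]
    ext n
    rw [fourierBasis_repr_compLpL, lpMap_apply, analysis_apply]
    rfl
  simp only [synthesis, sum_apply, ContinuousLinearMap.comp_apply]
  refine Lp.ext ?_
  refine (Lp.coeFn_finsetSum _ _).trans ?_
  have h1 := fun i : Fin m => (ContinuousLinearMap.toSpanSingleton ℝ
    (EuclideanSpace.single i 1 : Vec m) ∘L Complex.reCLM).coeFn_compLpL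
      ((coordC i).compLpL 2 haar f)
  filter_upwards [ae_all_iff.2 h1, ae_all_iff.2 fun i : Fin m => (coordC i).coeFn_compLpL f]
    with x hx hx2
  rw [Finset.sum_apply]
  ext j
  rw [WithLp.ofLp_sum, Finset.sum_apply]
  refine (Finset.sum_congr rfl fun i _ => ?_).trans
    (Finset.sum_ite_eq' Finset.univ j fun i => f x i) |>.trans (by simp)
  refine (congrArg (fun y : Vec m => y j) ((congrArg (fun g : Lp ℂ 2 haar =>
    ((ContinuousLinearMap.toSpanSingleton ℝ (EuclideanSpace.single i 1 : Vec m)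
      ∘L Complex.reCLM).compLpL 2 haar g) x) (h i)).trans (hx i))).trans ?_
  rw [hx2 i]
  simp [eq_comm]

/-- The square summable sequence of the Fourier coefficients of a map in `L²`. -/
def coeffLp (f : Circ → Vec m) (hf : MemLp f 2 haar) : SqSummable m := analysis hf.toLp

theorem coeffLp_apply (f : Circ → Vec m) (hf : MemLp f 2 haar) (n : ℤ) :
    coeffLp f hf n = coeff f n := by
  rw [coeffLp, analysis_apply, coeff_congr_ae hf.coeFn_toLp]

theorem coeff_add {f g : Circ → Vec m} (hf : MemLp f 2 haar) (hg : MemLp g 2 haar) :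
    coeff (f + g) = coeff f + coeff g := by
  funext n
  rw [← coeffLp_apply _ (hf.add hg), coeffLp, MemLp.toLp_add hf hg, map_add, lp.coeFn_add]
  simp only [Pi.add_apply]
  exact congrArg₂ _ (coeffLp_apply f hf n) (coeffLp_apply g hg n)

theorem coeff_sub {f g : Circ → Vec m} (hf : MemLp f 2 haar) (hg : MemLp g 2 haar) :
    coeff (f - g) = coeff f - coeff g := by
  funext n
  rw [← coeffLp_apply _ (hf.sub hg), coeffLp, MemLp.toLp_sub hf hg, map_sub, lp.coeFn_sub]
  simp only [Pi.sub_apply]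
  exact congrArg₂ _ (coeffLp_apply f hf n) (coeffLp_apply g hg n)

theorem coeff_smul (r : ℝ) {f : Circ → Vec m} (hf : MemLp f 2 haar) :
    coeff (r • f) = r • coeff f := by
  funext n
  rw [← coeffLp_apply _ (hf.const_smul r), coeffLp, MemLp.toLp_const_smul r hf, map_smul,
    lp.coeFn_smul]
  exact congrArg (r • ·) (coeffLp_apply f hf n)

theorem l2Inner_eq (f g : SqSummable m) : l2Inner f g = 2 * π * inner ℝ f g := by
  rw [lp.inner_eq_tsum, l2Inner]
  congr 2
  funext n
  rw [PiLp.inner_apply, Complex.re_sum]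
  simp [mul_comm]

/-! ### Reality -/

section Products

theorem isReal_coeff (f : Circ → Vec m) : IsReal (coeff f) := by
  intro n i
  simp only [coeff, fourierCoeff]
  rw [← integral_conj]
  refine integral_congr_ae (.of_forall fun θ => ?_)
  simp only [smul_eq_mul, map_mul, Complex.conj_ofReal, ← fourier_neg]

theorem IsReal.add {c d : Series m} (hc : IsReal c) (hd : IsReal d) : IsReal (c + d) :=
  fun n i => by simp [hc n i, hd n i]

theorem IsReal.smul {c : Series m} (hc : IsReal c) (r : ℝ) : IsReal (r • c) :=
  fun n i => by simp [hc n i]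

theorem IsReal.dtheta {c : Series m} (hc : IsReal c) : IsReal (dtheta c) :=
  fun n i => by simp [HalfHarmonic.dtheta, hc n i]

theorem IsReal.invFracLap {c : Series m} (hc : IsReal c) (α : ℝ) : IsReal (invFracLap α c) := by
  intro n i
  rcases eq_or_ne n 0 with rfl | hn
  · simp [HalfHarmonic.invFracLap]
  · simp [HalfHarmonic.invFracLap, hn, hc n i]

/-! ### Products -/

theorem fourierCoeff_eq_inner {f : Circ → ℂ} (hf : MemLp f 2 haar) (n : ℤ) :
    inner ℂ (fourierBasis (T := 2 * π) n) hf.toLp = fourierCoeff f n := by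
  rw [← HilbertBasis.repr_apply_apply, fourierBasis_repr, fourierCoeff_congr_ae hf.coeFn_toLp]

/-- The Fourier coefficients of the product of two functions in `L²`. -/
theorem hasSum_fourierCoeff_mul {a b : Circ → ℂ} (ha : MemLp a 2 haar) (hb : MemLp b 2 haar)
    (n : ℤ) :
    HasSum (fun k => fourierCoeff a (n - k) * fourierCoeff b k)
      (fourierCoeff (fun θ => a θ * b θ) n) := by
  -- Parseval for the pair `conj a · e^{inθ}` and `b`: conjugation puts `a` in the product, and the
  -- modulation produces the shift `n - k`.
  have hx : MemLp (fun θ : Circ => conj (a θ) * fourier n θ) 2 haar := by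
    refine MemLp.of_le ha ?_ (.of_forall fun θ => ?_)
    · exact (Complex.continuous_conj.comp_aestronglyMeasurable ha.1).mul
        (map_continuous (fourier n)).aestronglyMeasurable
    · rw [norm_mul, RCLike.norm_conj, fourier_apply, Circle.norm_coe, mul_one]
  have h := (fourierBasis (T := 2 * π)).hasSum_inner_mul_inner hx.toLp hb.toLp
  have h1 : ∀ k, inner ℂ hx.toLp (fourierBasis (T := 2 * π) k) = fourierCoeff a (n - k) := by
    intro k
    rw [← inner_conj_symm, fourierCoeff_eq_inner, fourierCoeff, fourierCoeff, ← integral_conj]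
    refine integral_congr_ae (.of_forall fun θ => ?_)
    simp only [smul_eq_mul, map_mul, Complex.conj_conj, ← fourier_neg]
    rw [mul_left_comm, mul_comm, ← fourier_add, show - -k + -n = -(n - k) by ring]
  have h2 : inner ℂ hx.toLp hb.toLp = fourierCoeff (fun θ => a θ * b θ) n := by
    rw [L2.inner_def, fourierCoeff]
    refine integral_congr_ae ?_
    filter_upwards [hx.coeFn_toLp, hb.coeFn_toLp] with θ h3 h4
    rw [h3, h4]
    simp only [RCLike.inner_apply, map_mul, Complex.conj_conj, ← fourier_neg, smul_eq_mul]
    ring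
  simpa only [h1, h2, fourierCoeff_eq_inner] using h

/-- The pointwise product of a field of matrices with a map. -/
def mulField (M : Circ → Matrix (Fin m) (Fin m) ℝ) (f : Circ → Vec m) : Circ → Vec m :=
  fun θ => WithLp.toLp 2 (M θ *ᵥ (f θ).ofLp)

/-- A measurable field of matrices with entries in `[-1, 1]`. -/
structure IsBddField (M : Circ → Matrix (Fin m) (Fin m) ℝ) : Prop where
  meas : ∀ i j, AEStronglyMeasurable (fun θ => M θ i j) haar
  le_one : ∀ θ i j, |M θ i j| ≤ 1

variable {M : Circ → Matrix (Fin m) (Fin m) ℝ} {f g : Circ → Vec m}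

theorem IsBddField.memLp (hM : IsBddField M) (i j : Fin m) : MemLp (fun θ => M θ i j) 2 haar :=
  MemLp.of_bound (hM.meas i j) 1 (.of_forall fun θ => hM.le_one θ i j)

theorem memLp_mulField (hM : IsBddField M) (hf : MemLp f 2 haar) :
    MemLp (mulField M f) 2 haar := by
  refine MemLp.of_eval_piLp fun i => ?_
  simp only [mulField, Matrix.mulVec, dotProduct]
  refine memLp_finsetSum _ fun j _ => MemLp.of_le (hf.eval_piLp j) ?_ (.of_forall fun θ => ?_)
  · exact (hM.meas i j).mul (hf.eval_piLp j).1
  · rw [norm_mul]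
    exact mul_le_of_le_one_left (norm_nonneg _) (hM.le_one θ i j)

theorem memLp_ofReal {a : Circ → ℝ} (ha : MemLp a 2 haar) :
    MemLp (fun θ => (a θ : ℂ)) 2 haar := ha.ofReal

theorem hasSum_matCoeff_mul_coeff (hM : IsBddField M) (hf : MemLp f 2 haar) (i j : Fin m) (n : ℤ) :
    HasSum (fun k => matCoeff M (n - k) i j * coeff f k j)
      (fourierCoeff (fun θ : Circ => ((M θ i j : ℝ) : ℂ) * ((f θ j : ℝ) : ℂ)) n) :=
  hasSum_fourierCoeff_mul (memLp_ofReal (hM.memLp i j)) (memLp_ofReal (hf.eval_piLp j)) n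

theorem mulDist_coeff (hM : IsBddField M) (hf : MemLp f 2 haar) :
    mulDist M (coeff f) = coeff (mulField M f) := by
  funext n
  ext i
  simp only [mulDist, (hasSum_matCoeff_mul_coeff hM hf i _ n).tsum_eq]
  have hint : ∀ j ∈ Finset.univ, Integrable
      (fun θ : Circ => ((M θ i j : ℝ) : ℂ) * ((f θ j : ℝ) : ℂ)) haar := fun j _ =>
    (memLp_ofReal (hM.memLp i j)).integrable_mul (memLp_ofReal (hf.eval_piLp j))
  rw [← Finset.sum_apply, ← fourierCoeff.sum _ _ hint, coeff]
  congr 1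
  funext θ
  simp [mulField, Matrix.mulVec, dotProduct]

/-- The products that define `mulDist M c` converge absolutely. -/
def MulSummable (M : Circ → Matrix (Fin m) (Fin m) ℝ) (c : Series m) : Prop :=
  ∀ n i j, Summable fun k => matCoeff M (n - k) i j * c k j

theorem mulSummable_coeff (hM : IsBddField M) (hf : MemLp f 2 haar) : MulSummable M (coeff f) :=
  fun n i j => (hasSum_matCoeff_mul_coeff hM hf i j n).summable

theorem mulDist_add {c d : Series m} (hc : MulSummable M c) (hd : MulSummable M d) :
    mulDist M (c + d) = mulDist M c + mulDist M d := by
  funext n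
  ext i
  simp only [mulDist, Pi.add_apply, PiLp.add_apply, mul_add, ← Finset.sum_add_distrib]
  exact Finset.sum_congr rfl fun j _ => (hc n i j).tsum_add (hd n i j)

theorem mulDist_smul (r : ℝ) (c : Series m) : mulDist M (r • c) = r • mulDist M c := by
  funext n
  ext i
  simp only [mulDist, Pi.smul_apply, PiLp.smul_apply, Finset.smul_sum]
  refine Finset.sum_congr rfl fun j _ => ?_
  -- Scalars pass through `tsum` with no summability assumption.
  rw [← tsum_const_smul'']
  exact tsum_congr fun k => mul_smul_comm _ _ _

theorem fourierCoeff_const (c : ℂ) (n : ℤ) :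
    fourierCoeff (fun _ : Circ => c) n = if n = 0 then c else 0 := by
  have hc : (fun _ : Circ => c) = c • ⇑(fourier (T := 2 * π) 0) := by
    funext θ
    simp
  rw [hc, fourierCoeff.const_smul, fourierCoeff_fourier]
  by_cases h : n = 0 <;> simp [h]

theorem matCoeff_one_sub (hM : IsBddField M) (n : ℤ) (i j : Fin m) :
    matCoeff (fun θ => 1 - M θ) n i j = (if n = 0 then (1 : Matrix (Fin m) (Fin m) ℂ) i j else 0)
      - matCoeff M n i j := by
  have h1 : (((1 : Matrix (Fin m) (Fin m) ℝ) i j : ℝ) : ℂ)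
      = (1 : Matrix (Fin m) (Fin m) ℂ) i j := by
    by_cases h : i = j <;> simp [Matrix.one_apply, h]
  rw [← h1, ← fourierCoeff_const]
  simp only [matCoeff, Matrix.of_apply, fourierCoeff]
  rw [← integral_sub]
  · refine integral_congr_ae (.of_forall fun θ => ?_)
    simp only [Matrix.sub_apply, Complex.ofReal_sub, smul_sub]
  · exact (integrable_const _).fourier_smul _
  · exact ((memLp_ofReal (hM.memLp i j)).integrable one_le_two).fourier_smul _

/-- The constant field `1` contributes only the term `k = n`; convergence of the other sum allows
the two to be split. -/
theorem mulDist_one_sub (hM : IsBddField M) {c : Series m} (hc : MulSummable M c) :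
    mulDist (fun θ => 1 - M θ) c = c - mulDist M c := by
  funext n
  ext i
  simp only [mulDist, Pi.sub_apply, PiLp.sub_apply, matCoeff_one_sub hM, sub_mul]
  have h1 : ∀ j, HasSum (fun k => (if n - k = 0 then (1 : Matrix (Fin m) (Fin m) ℂ) i j else 0)
      * c k j) ((1 : Matrix (Fin m) (Fin m) ℂ) i j * c n j) := fun j => by
    have h := hasSum_single (f := fun k => (if n - k = 0 then
      (1 : Matrix (Fin m) (Fin m) ℂ) i j else 0) * c k j) n fun k hk => by
        rw [if_neg (sub_ne_zero.2 hk.symm), zero_mul]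
    simpa only [sub_self, if_true] using h
  simp only [fun j => ((h1 j).sub (hc n i j).hasSum).tsum_eq, Finset.sum_sub_distrib]
  congr 1
  simp [Matrix.one_apply]

theorem summable_abs_mul_norm_sq {c : Series m} (hc : Memℓp (bessel (1 / 2) c) 2) :
    Summable fun n : ℤ => (1 + |(n : ℝ)|) * ‖c n‖ ^ 2 := by
  rw [memℓp_gen_iff (by simp)] at hc
  simp only [ENNReal.toReal_ofNat, Real.rpow_ofNat] at hc
  refine Summable.of_nonneg_of_le (fun n => by positivity) (fun n => ?_) (hc.mul_left 2)
  have h0 : (0 : ℝ) ≤ 1 + (n : ℝ) ^ 2 := by positivity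
  have h3 : ((1 + (n : ℝ) ^ 2) ^ (1 / 2 / 2 : ℝ)) ^ 2 = √(1 + (n : ℝ) ^ 2) := by
    rw [← Real.rpow_mul_natCast h0, Real.sqrt_eq_rpow]
    norm_num
  rw [bessel, norm_smul, mul_pow, Real.norm_of_nonneg (by positivity), h3, ← mul_assoc]
  gcongr
  have h1 : 1 ≤ √(1 + (n : ℝ) ^ 2) := Real.one_le_sqrt.2 (by nlinarith)
  have h2 : |(n : ℝ)| ≤ √(1 + (n : ℝ) ^ 2) := Real.abs_le_sqrt (by linarith)
  linarith

/-- The product of `H^{1/2}` and `H^{-1/2}` converges. -/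
theorem mulSummable_dtheta {c : Series m} (hM : MatMemHHalf M)
    (hc : Memℓp (bessel (1 / 2) c) 2) : MulSummable M (dtheta c) := by
  intro n i j
  have h1 := summable_abs_mul_norm_sq hc
  have h2 := summable_abs_mul_norm_sq (hM j).2.2
  have h3 := ((Equiv.subLeft n).summable_iff.2 h2).mul_left (1 + |(n : ℝ)|)
  refine Summable.of_norm_bounded (h1.add h3) fun k => ?_
  have hm : ‖matCoeff M (n - k) i j‖
      ≤ ‖coeff (fun θ => WithLp.toLp 2 (fun i => M θ i j) : Circ → Vec m) (n - k)‖ :=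
    PiLp.norm_apply_le (coeff (fun θ => WithLp.toLp 2 (fun i => M θ i j) : Circ → Vec m) (n - k)) i
  set a := ‖coeff (fun θ => WithLp.toLp 2 (fun i => M θ i j) : Circ → Vec m) (n - k)‖ with ha
  have hck : ‖c k j‖ ≤ ‖c k‖ := PiLp.norm_apply_le _ j
  -- The derivative costs a factor `|k|`. It is shared by the two H^{1/2} factors through `ab ≤ a² +
  -- b²`; on the matrix factor it is moved to the frequency `n - k`, at the price of the constant `1
  -- + |n|`.
  have hk : |(k : ℝ)| ≤ |(n : ℝ)| + |(n : ℝ) - k| := by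
    simpa using abs_sub (n : ℝ) ((n : ℝ) - k)
  simp only [Function.comp_apply, Equiv.subLeft_apply, ← ha, dtheta, PiLp.smul_apply, smul_eq_mul,
    norm_mul, Complex.norm_I, one_mul, Complex.norm_intCast, Int.cast_sub]
  have hn := abs_nonneg (n : ℝ)
  have hnk := abs_nonneg ((n : ℝ) - k)
  calc ‖matCoeff M (n - k) i j‖ * (|(k : ℝ)| * ‖c k j‖) ≤ a * (|(k : ℝ)| * ‖c k‖) := by gcongr
    _ = |(k : ℝ)| * (a * ‖c k‖) := by ring
    _ ≤ |(k : ℝ)| * (‖c k‖ ^ 2 + a ^ 2) := by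
        gcongr
        nlinarith [sq_nonneg (a - ‖c k‖), sq_nonneg a, sq_nonneg ‖c k‖]
    _ = |(k : ℝ)| * ‖c k‖ ^ 2 + |(k : ℝ)| * a ^ 2 := by ring
    _ ≤ (1 + |(k : ℝ)|) * ‖c k‖ ^ 2 + ((1 + |(n : ℝ)|) * (1 + |(n : ℝ) - k|)) * a ^ 2 := by
        gcongr
        · linarith
        · nlinarith
    _ = _ := by ring

theorem matMemHHalf_one_sub (hM : MatMemHHalf M) : MatMemHHalf fun θ => 1 - M θ := by
  intro j
  set e : Circ → Vec m := fun _ => EuclideanSpace.single j 1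
  set f : Circ → Vec m := fun θ => WithLp.toLp 2 fun i => M θ i j
  have hf : MemLp f 2 haar := memLp_haar_iff.2 (hM j).1
  have he : MemLp e 2 haar := memLp_const _
  have hef : (fun θ => WithLp.toLp 2 fun i => (1 - M θ) i j : Circ → Vec m) = e - f := by
    funext θ
    ext i
    simp [e, f, Matrix.one_apply]
  rw [hef]
  refine ⟨memLp_haar_iff.1 (he.sub hf), isReal_coeff _, ?_⟩
  -- A constant map has only the frequency zero, where the Bessel weight is 1.
  have hbe : bessel (1 / 2) (coeff e) = ⇑(coeffLp e he) := by
    funext n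
    rw [coeffLp_apply, bessel]
    rcases eq_or_ne n 0 with rfl | hn
    · simp
    · have : coeff e n = 0 := by
        ext i
        exact (fourierCoeff_const (((EuclideanSpace.single j 1 : Vec m) i : ℝ) : ℂ) n).trans
          (if_neg hn)
      rw [this, smul_zero]
  have hsub : bessel (1 / 2) (coeff (e - f)) = ⇑(coeffLp e he) - bessel (1 / 2) (coeff f) := by
    rw [← hbe, coeff_sub he hf]
    funext n
    simp only [bessel, Pi.sub_apply, smul_sub]
  rw [hsub]
  exact (lp.memℓp _).sub (hM j).2.2

end Products

/-! ### Orthogonal projections -/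

section Projections

/-- A diagonal entry is the squared norm of its column, `P j j = ∑ k, P k j ^ 2`; hence `P j j ^ 2 ≤
P j j ≤ 1`, and `P j j` bounds the squares of the column's entries. Projection fields are thus
bounded multipliers of L² with no growth assumption on `PT`. -/
theorem abs_apply_le_one_of_idem {P : Matrix (Fin m) (Fin m) ℝ} (h1 : P * P = P) (h2 : Pᵀ = P)
    (i j : Fin m) : |P i j| ≤ 1 := by
  have h : P j j = ∑ k, P k j ^ 2 := by
    conv_lhs => rw [← h1, Matrix.mul_apply]
    refine Finset.sum_congr rfl fun k _ => ?_
    rw [sq, ← congrFun (congrFun h2 k) j]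
    rfl
  have h3 : ∀ k, P k j ^ 2 ≤ P j j := fun k => by
    rw [h]
    exact Finset.single_le_sum (f := fun k => P k j ^ 2) (fun _ _ => sq_nonneg _)
      (Finset.mem_univ k)
  rw [← sq_le_one_iff_abs_le_one]
  nlinarith [h3 i, h3 j]

variable {PT : Vec m → Matrix (Fin m) (Fin m) ℝ} {u v : Circ → Vec m}

namespace IsPlaneDistribution

/-- Orthogonality says `Pᵀ(1 - P) = 0`, so `Pᵀ = PᵀP`, which is symmetric. -/
theorem transpose_eq (hPT : IsPlaneDistribution PT) (z : Vec m) : (PT z)ᵀ = PT z := by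
  have h : (PT z)ᵀ * (1 - PT z) = 0 := by
    ext i j
    have := hPT.orth z (Pi.single i 1) (Pi.single j 1)
    simpa [Matrix.mul_apply, dotProduct] using this
  have h1 : (PT z)ᵀ = (PT z)ᵀ * PT z := by
    rwa [mul_sub, mul_one, sub_eq_zero] at h
  have h2 := congrArg Matrix.transpose h1
  rw [Matrix.transpose_mul, Matrix.transpose_transpose] at h2
  rw [h1, ← h2]

theorem mul_normalProj (hPT : IsPlaneDistribution PT) (z : Vec m) :
    PT z * normalProj PT z = 0 := by
  rw [normalProj, mul_sub, mul_one, hPT.idem, sub_self]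

theorem normalProj_mul (hPT : IsPlaneDistribution PT) (z : Vec m) :
    normalProj PT z * PT z = 0 := by
  rw [normalProj, sub_mul, one_mul, hPT.idem, sub_self]

theorem normalProj_idem (hPT : IsPlaneDistribution PT) (z : Vec m) :
    normalProj PT z * normalProj PT z = normalProj PT z := by
  nth_rw 1 [normalProj]
  rw [sub_mul, one_mul, hPT.mul_normalProj, sub_zero]

theorem isBddField (hPT : IsPlaneDistribution PT) (hu : AEStronglyMeasurable u haar) :
    IsBddField fun θ => PT (u θ) where
  meas i j := (hPT.contDiff i j).continuous.comp_aestronglyMeasurable hu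
  le_one _ := abs_apply_le_one_of_idem (hPT.idem _) (hPT.transpose_eq _)

theorem isBddField_normal (hPT : IsPlaneDistribution PT) (hu : AEStronglyMeasurable u haar) :
    IsBddField fun θ => normalProj PT (u θ) where
  meas i j := aestronglyMeasurable_const.sub ((hPT.isBddField hu).meas i j)
  le_one _ := abs_apply_le_one_of_idem (hPT.normalProj_idem _) (by
    rw [normalProj, Matrix.transpose_sub, Matrix.transpose_one, hPT.transpose_eq])

end IsPlaneDistribution

theorem mulField_mulField (M N : Circ → Matrix (Fin m) (Fin m) ℝ) (f : Circ → Vec m) :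
    mulField M (mulField N f) = mulField (fun θ => M θ * N θ) f := by
  funext θ
  simp [mulField, Matrix.mulVec_mulVec]

theorem mulField_zero (f : Circ → Vec m) : mulField (fun _ => 0) f = 0 := by
  funext θ
  simp [mulField]

theorem mulField_sub (M : Circ → Matrix (Fin m) (Fin m) ℝ) (f g : Circ → Vec m) :
    mulField M (f - g) = mulField M f - mulField M g := by
  funext θ
  ext i
  simp [mulField, Matrix.mulVec_sub]

/-! ### Smooth maps -/

namespace IsSmooth

theorem continuous (hu : IsSmooth u) : Continuous u :=
  (QuotientAddGroup.isQuotientMap_mk _).continuous_iff.2 (ContDiff.continuous hu)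

end IsSmooth

theorem memLp_of_continuous {E : Type*} [NormedAddCommGroup E] {f : Circ → E}
    (hf : Continuous f) : MemLp f 2 haar := by
  obtain ⟨C, hC⟩ := isCompact_univ.exists_bound_of_continuousOn hf.continuousOn
  exact MemLp.of_bound hf.aestronglyMeasurable C (.of_forall fun θ => hC θ (mem_univ θ))

/-- The derivative of a map on the circle. -/
def derivCirc (u : Circ → Vec m) : Circ → Vec m :=
  Function.Periodic.lift (f := deriv fun x : ℝ => u (x : Circ)) (c := 2 * π) fun x => by
    rw [← deriv_comp_add_const]
    simp only [AddCircle.coe_add_period]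

theorem continuous_derivCirc (hu : IsSmooth u) : Continuous (derivCirc u) :=
  (QuotientAddGroup.isQuotientMap_mk _).continuous_iff.2
    (ContDiff.continuous_deriv hu (by simp))

theorem coeff_derivCirc (hu : IsSmooth u) : coeff (derivCirc u) = dtheta (coeff u) := by
  funext n
  ext i
  have hd : ∀ x : ℝ, HasDerivAt (fun x : ℝ => ((u (x : Circ) i : ℝ) : ℂ))
      ((derivCirc u (x : Circ) i : ℝ) : ℂ) x := fun x =>
    (coordC i).hasFDerivAt.comp_hasDerivAt x
      ((ContDiff.differentiable hu (by simp)) x).hasDerivAt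
  have hf : ∀ x : ℝ, HasDerivAt (fun y : ℝ => (fourier (-n) (y : Circ) : ℂ))
      (-(Complex.I * n) * fourier (-n) (x : Circ)) x := fun x => by
    convert! hasDerivAt_fourier_neg (2 * π) n x using 2
    have : (π : ℂ) ≠ 0 := by exact_mod_cast Real.pi_ne_zero
    push_cast
    field_simp
  have hc : Continuous fun x : ℝ => (fourier (-n) (x : Circ) : ℂ) :=
    (map_continuous (fourier (-n))).comp (AddCircle.continuous_mk' _)
  have hu' : Continuous fun x : ℝ => ((derivCirc u (x : Circ) i : ℝ) : ℂ) :=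
    (coordC i).continuous.comp ((continuous_derivCirc hu).comp (AddCircle.continuous_mk' _))
  have hibp := intervalIntegral.integral_mul_deriv_eq_deriv_mul (a := 0) (b := 0 + 2 * π)
    (fun x _ => hf x) (fun x _ => hd x) ((hc.const_mul _).intervalIntegrable _ _)
    (hu'.intervalIntegrable _ _)
  -- Periodicity cancels the boundary terms of the integration by parts.
  have hper : (((0 : ℝ) + 2 * π : ℝ) : Circ) = ((0 : ℝ) : Circ) := AddCircle.coe_add_period _ 0
  rw [hper, sub_self, zero_sub] at hibp
  simp only [coeff, dtheta, PiLp.smul_apply]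
  rw [fourierCoeff_eq_intervalIntegral _ n 0, fourierCoeff_eq_intervalIntegral _ n 0]
  simp only [smul_eq_mul]
  rw [hibp, ← intervalIntegral.integral_neg, mul_smul_comm, ← intervalIntegral.integral_const_mul]
  congr 2
  funext x
  ring

/-! ### Sequences in `ℓ²` -/

theorem coe_coeffLp (hv : MemLp v 2 haar) : ⇑(coeffLp v hv) = coeff v :=
  funext (coeffLp_apply v hv)

/-- The operator `(-Δ)₀^{-1/4}` on `ℓ²`. -/
def quarterInv : SqSummable m →L[ℝ] SqSummable m :=
  diag (fun n => if n = 0 then 0 else ((|(n : ℝ)| ^ (-(1 / 2) : ℝ) : ℝ) : ℂ)) fun n => by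
    split_ifs with hn
    · simp
    · have h1 : (1 : ℝ) ≤ |(n : ℝ)| := by exact_mod_cast Int.one_le_abs hn
      rw [Complex.norm_real, Real.norm_of_nonneg (by positivity)]
      exact Real.rpow_le_one_of_one_le_of_nonpos h1 (by norm_num)

theorem invFracLap_coe (x : SqSummable m) : invFracLap (1 / 2) ⇑x = ⇑(quarterInv x) := by
  funext n
  rw [quarterInv, diag_apply, invFracLap]
  split_ifs with hn
  · simp
  · rfl

theorem invFracLap_coeff (hv : MemLp v 2 haar) :
    invFracLap (1 / 2) (coeff v) = ⇑(quarterInv (coeffLp v hv)) := by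
  rw [← coe_coeffLp hv, invFracLap_coe]

theorem bessel_zero (c : Series m) : bessel 0 c = c := by
  funext n
  simp [bessel]

/-- The isometry of `H^{-1/2}` with `ℓ²`, restricted to `ℓ²`. -/
def quarterBessel : SqSummable m →L[ℝ] SqSummable m :=
  diag (fun n => (((1 + (n : ℝ) ^ 2) ^ (-(1 / 2) / 2 : ℝ) : ℝ) : ℂ)) fun n => by
    rw [Complex.norm_real, Real.norm_of_nonneg (by positivity)]
    exact Real.rpow_le_one_of_one_le_of_nonpos (by nlinarith [sq_nonneg (n : ℝ)]) (by norm_num)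

theorem bessel_neg_coe (x : SqSummable m) : bessel (-(1 / 2)) ⇑x = ⇑(quarterBessel x) := rfl

theorem memSobolev_zero {c : Series m} (hc : IsReal c) (x : SqSummable m) (hx : c = ⇑x) :
    MemSobolev 0 c :=
  ⟨hc, by rw [bessel_zero, hx]; exact lp.memℓp x⟩

theorem memSobolev_invFracLap (hv : MemLp v 2 haar) :
    MemSobolev 0 (invFracLap (1 / 2) (coeff v)) :=
  memSobolev_zero ((isReal_coeff v).invFracLap _) _ (invFracLap_coeff hv)

theorem isC1Curve_zero {c : ℝ → Series m} {Γ : ℝ → SqSummable m}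
    (hΓ : ContDiffOn ℝ 1 Γ (Ioo (-1) 1)) (h : ∀ t ∈ Ioo (-1 : ℝ) 1, c t = ⇑(Γ t)) :
    IsC1Curve 0 c :=
  ⟨Γ, hΓ, fun t ht n => by rw [bessel_zero, h t ht]⟩

theorem isC1Curve_neg {c : ℝ → Series m} {Γ : ℝ → SqSummable m}
    (hΓ : ContDiffOn ℝ 1 Γ (Ioo (-1) 1)) (h : ∀ t ∈ Ioo (-1 : ℝ) 1, c t = ⇑(Γ t)) :
    IsC1Curve (-(1 / 2)) c :=
  ⟨fun t => quarterBessel (Γ t), quarterBessel.contDiff.comp_contDiffOn hΓ, fun t ht n => by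
    rw [h t ht, bessel_neg_coe]⟩

theorem isC1Curve_const {s : ℝ} {c : Series m} (hc : Memℓp (bessel s c) 2) :
    IsC1Curve s fun _ => c :=
  ⟨fun _ => ⟨bessel s c, hc⟩, contDiffOn_const, fun _ _ _ => rfl⟩

theorem contDiff_line (x y : SqSummable m) : ContDiff ℝ 1 fun t : ℝ => x + t • y := by
  fun_prop

end Projections

/-! ### Variations of the multiplier -/

section Multiplier

variable {PT : Vec m → Matrix (Fin m) (Fin m) ℝ} {M : Circ → Matrix (Fin m) (Fin m) ℝ}
  {u ξ η f : Circ → Vec m}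

/-- The sequence of Fourier coefficients of `(-Δ)₀^{-1/4} (M f)`. -/
def quarterInvMul (hM : IsBddField M) (hf : MemLp f 2 haar) : SqSummable m :=
  quarterInv (coeffLp (mulField M f) (memLp_mulField hM hf))

theorem invFracLap_mulDist_coeff (hM : IsBddField M) (hf : MemLp f 2 haar) :
    invFracLap (1 / 2) (mulDist M (coeff f)) = ⇑(quarterInvMul hM hf) := by
  rw [mulDist_coeff hM hf, invFracLap_coeff (memLp_mulField hM hf), quarterInvMul]

theorem invFracLap_mulDist_line (hM : IsBddField M) (hξ : MemLp ξ 2 haar) (hη : MemLp η 2 haar)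
    (t : ℝ) : invFracLap (1 / 2) (mulDist M (coeff ξ + t • coeff η))
      = ⇑(quarterInvMul hM hξ + t • quarterInvMul hM hη) := by
  have hs : MulSummable M (t • coeff η) := fun n i j => by
    simpa only [Pi.smul_apply, PiLp.smul_apply, mul_smul_comm] using
      (mulSummable_coeff hM hη n i j).const_smul t
  rw [mulDist_add (mulSummable_coeff hM hξ) hs, mulDist_smul, mulDist_coeff hM hξ,
    mulDist_coeff hM hη, ← coe_coeffLp (memLp_mulField hM hξ), ← coe_coeffLp (memLp_mulField hM hη),
    quarterInvMul, quarterInvMul, ← map_smul, ← map_add, ← invFracLap_coe]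
  rfl

theorem quarterInvMul_sub (hM : IsBddField M) (hξ : MemLp ξ 2 haar) (hη : MemLp η 2 haar) :
    quarterInvMul hM (hξ.sub hη) = quarterInvMul hM hξ - quarterInvMul hM hη := by
  rw [quarterInvMul, quarterInvMul, quarterInvMul, ← map_sub]
  congr 1
  ext1
  rw [lp.coeFn_sub, coe_coeffLp, coe_coeffLp, coe_coeffLp, mulField_sub,
    coeff_sub (memLp_mulField hM hξ) (memLp_mulField hM hη)]

theorem quarterInvMul_congr {N : Circ → Matrix (Fin m) (Fin m) ℝ} {g : Circ → Vec m}
    (hM : IsBddField M) (hN : IsBddField N) (hf : MemLp f 2 haar)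
    (hg : MemLp g 2 haar) (h : mulField M f = mulField N g) :
    quarterInvMul hM hf = quarterInvMul hN hg := by
  simp only [quarterInvMul, h]

theorem quarterInvMul_eq_zero (hM : IsBddField M) (hf : MemLp f 2 haar) (h : mulField M f = 0) :
    quarterInvMul hM hf = 0 := by
  have : coeffLp (mulField M f) (memLp_mulField hM hf) = 0 := by
    ext1
    rw [coe_coeffLp, h]
    funext n
    ext i
    simp [coeff, fourierCoeff]
  rw [quarterInvMul, this, map_zero]

/-- The Euler-Lagrange equation for variations of `ξ`. -/
theorem inner_eq_of_isCriticalPoint (hu : IsSmooth u) (hξ : MemLp ξ 2 haar) (hη : MemLp η 2 haar)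
    (hP : IsBddField fun θ => PT (u θ)) (hN : IsBddField fun θ => normalProj PT (u θ))
    (hu' : MemLp (derivCirc u) 2 haar)
    (hcrit : IsCriticalPoint PT u (coeff ξ)) :
    inner ℝ (quarterInvMul hP hξ - quarterInvMul hP hu') (quarterInvMul hP hη)
      = inner ℝ (quarterInvMul hN hη) (quarterInvMul hN hu') := by
  set a := quarterInvMul hP hξ
  set b := quarterInvMul hP hη
  set B := quarterInvMul hP hu'
  set c := quarterInvMul hN hξ
  set d := quarterInvMul hN hη
  set D := quarterInvMul hN hu'
  obtain ⟨hE, hcrit⟩ := hcrit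
  have hreal : ∀ t : ℝ, IsReal (coeff ξ + t • coeff η) := fun t =>
    (isReal_coeff ξ).add ((isReal_coeff η).smul t)
  have hζ : ∀ t : ℝ, coeff ξ + t • coeff η = ⇑(coeffLp ξ hξ + t • coeffLp η hη) := fun t => by
    rw [← coe_coeffLp hξ, ← coe_coeffLp hη]
    rfl
  have hmul : ∀ t : ℝ, mulDist (fun θ => PT (u θ)) (coeff ξ + t • coeff η)
      = coeff (mulField (fun θ => PT (u θ)) (ξ + t • η)) := fun t => by
    rw [← mulDist_coeff hP (hξ.add (hη.const_smul t)), coeff_add hξ (hη.const_smul t),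
      coeff_smul t hη]
  -- With `u` frozen, the constraint holds trivially along the line and only the multiplier moves.
  have hcurve : IsC1CurveE PT (fun _ => u) (fun t => coeff ξ + t • coeff η) := by
    refine ⟨fun t _ => ⟨hE.mem_fst, ?_, hE.proj_mem, hE.constraint, ?_, hE.tangent_fst⟩, ?_, ?_, ?_,
      ?_⟩
    · refine ⟨hreal t, ?_⟩
      rw [hζ, bessel_neg_coe]
      exact lp.memℓp _
    · rw [hmul t]
      exact memSobolev_invFracLap (memLp_mulField hP (hξ.add (hη.const_smul t)))
    · exact isC1Curve_const hE.mem_fst.2.2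
    · exact isC1Curve_neg (contDiff_line _ _).contDiffOn fun t _ => hζ t
    · exact isC1Curve_zero (contDiff_line a b).contDiffOn fun t _ =>
        invFracLap_mulDist_line hP hξ hη t
    · exact isC1Curve_const hE.tangent_fst.2
  have hL := hcrit _ _ hcurve (ae_eq_refl u) (by simp)
  have hform : (fun t : ℝ => lagrangian PT u (coeff ξ + t • coeff η)) = fun t =>
      2 * π * inner ℝ (a + t • b) (a + t • b) / 2 - 2 * π * inner ℝ (a + t • b) B
        - 2 * π * inner ℝ (c + t • d) D := by
    funext t
    rw [lagrangian, invFracLap_mulDist_line hP hξ hη, invFracLap_mulDist_line hN hξ hη,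
      ← coeff_derivCirc hu, invFracLap_mulDist_coeff hP hu', invFracLap_mulDist_coeff hN hu',
      l2Inner_eq, l2Inner_eq, l2Inner_eq]
  have hpoly : (fun t : ℝ => 2 * π * inner ℝ (a + t • b) (a + t • b) / 2
      - 2 * π * inner ℝ (a + t • b) B - 2 * π * inner ℝ (c + t • d) D) = fun t =>
      (π * inner ℝ a a - 2 * π * inner ℝ a B - 2 * π * inner ℝ c D)
        + t * (2 * π * (inner ℝ a b - inner ℝ b B - inner ℝ d D)) + t ^ 2 * (π * inner ℝ b b) := by
    funext t
    simp only [inner_add_left, inner_add_right, real_inner_smul_left, real_inner_smul_right,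
      real_inner_comm a b]
    ring
  rw [hform, hpoly] at hL
  have hd : HasDerivAt (fun t : ℝ => (π * inner ℝ a a - 2 * π * inner ℝ a B - 2 * π * inner ℝ c D)
        + t * (2 * π * (inner ℝ a b - inner ℝ b B - inner ℝ d D)) + t ^ 2 * (π * inner ℝ b b))
      (2 * π * (inner ℝ a b - inner ℝ b B - inner ℝ d D)) 0 := by
    have := (((hasDerivAt_id (0 : ℝ)).mul_const
      (2 * π * (inner ℝ a b - inner ℝ b B - inner ℝ d D))).const_add
      (π * inner ℝ a a - 2 * π * inner ℝ a B - 2 * π * inner ℝ c D)).add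
      (((hasDerivAt_id (0 : ℝ)).pow 2).mul_const (π * inner ℝ b b))
    simpa [Pi.add_def] using this
  have h0 := hL.unique hd
  have hpi : 2 * π ≠ 0 := by positivity
  have h1 := (mul_eq_zero.1 h0.symm).resolve_left hpi
  rw [inner_sub_left, real_inner_comm b B]
  linarith

/-- If `(u, ξ)` is critical, then `(-Δ)₀^{-1/4}(PN(u) du/dθ) = 0`. -/
theorem quarterInvMul_normal_eq_zero (hPT : IsPlaneDistribution PT) (hu : IsSmooth u)
    (hξ : MemLp ξ 2 haar)
    (hP : IsBddField fun θ => PT (u θ)) (hN : IsBddField fun θ => normalProj PT (u θ))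
    (hu' : MemLp (derivCirc u) 2 haar) (hcrit : IsCriticalPoint PT u (coeff ξ)) :
    quarterInvMul hN hu' = 0 := by
  -- Test direction η = P_N u': the tangential side vanishes and the normal side is a squared norm.
  have h := inner_eq_of_isCriticalPoint hu hξ (memLp_mulField hN hu') hP hN hu' hcrit
  rw [quarterInvMul_eq_zero hP (memLp_mulField hN hu'), inner_zero_right,
    quarterInvMul_congr hN hN (memLp_mulField hN hu') hu'] at h
  · exact inner_self_eq_zero.1 h.symm
  · rw [mulField_mulField]
    simp only [hPT.normalProj_idem]
  · rw [mulField_mulField]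
    simp only [hPT.mul_normalProj, mulField_zero]

/-- If `(u, ξ)` is critical, then `(-Δ)₀^{-1/4}(PT(u) (ξ - du/dθ)) = 0`. -/
theorem quarterInvMul_tangent_eq_zero (hPT : IsPlaneDistribution PT) (hu : IsSmooth u)
    (hξ : MemLp ξ 2 haar)
    (hP : IsBddField fun θ => PT (u θ)) (hN : IsBddField fun θ => normalProj PT (u θ))
    (hu' : MemLp (derivCirc u) 2 haar) (hcrit : IsCriticalPoint PT u (coeff ξ)) :
    quarterInvMul hP (hξ.sub hu') = 0 := by
  -- Test direction η = P_T(ξ - u'): now the normal side vanishes.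
  have h := inner_eq_of_isCriticalPoint hu hξ (memLp_mulField hP (hξ.sub hu')) hP hN hu' hcrit
  rw [quarterInvMul_eq_zero hN (memLp_mulField hP (hξ.sub hu')), inner_zero_left,
    quarterInvMul_congr hP hP (memLp_mulField hP (hξ.sub hu')) (hξ.sub hu'),
    ← quarterInvMul_sub] at h
  · exact inner_self_eq_zero.1 h
  · rw [mulField_mulField]
    simp only [hPT.idem]
  · rw [mulField_mulField]
    simp only [hPT.normalProj_mul, mulField_zero]

/-- Λ is injective on nonzero frequencies, so criticality kills those of P_N(u)u'; the frequency
zero, which Λ does not see, is killed by the constraint. -/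
theorem isHorizontal_of_isCriticalPoint (hPT : IsPlaneDistribution PT) (hu : IsSmooth u)
    (hξ : MemLp ξ 2 haar) (hcrit : IsCriticalPoint PT u (coeff ξ)) : IsHorizontal PT u := by
  have hum := hu.continuous.aestronglyMeasurable (μ := haar)
  have hP := hPT.isBddField hum
  have hN := hPT.isBddField_normal hum
  have hu' := memLp_of_continuous (continuous_derivCirc hu)
  have h0 := quarterInvMul_normal_eq_zero hPT hu hξ hP hN hu' hcrit
  refine ⟨hcrit.1.mem_fst, ?_, ?_⟩
  · exact matMemHHalf_one_sub hcrit.1.proj_mem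
  · funext n
    rcases eq_or_ne n 0 with rfl | hn
    · have := hcrit.1.constraint
      exact (smul_eq_zero.1 this).resolve_left (by positivity)
    · have h1 := congrFun (invFracLap_mulDist_coeff hN hu') n
      rw [h0, coeff_derivCirc hu, invFracLap, if_neg hn] at h1
      refine (smul_eq_zero.1 h1).resolve_left ?_
      have : 0 < |(n : ℝ)| := by positivity
      positivity

end Multiplier

/-! ### Curves of horizontal maps -/

theorem IsC1Curve.memℓp {s : ℝ} {c : ℝ → Series m} (hc : IsC1Curve s c) {t : ℝ}
    (ht : t ∈ Ioo (-1 : ℝ) 1) : Memℓp (bessel s (c t)) 2 := by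
  obtain ⟨Γ, -, h⟩ := hc
  rw [← funext (h t ht)]
  exact lp.memℓp _

theorem IsC1Curve.add {s : ℝ} {c d : ℝ → Series m} (hc : IsC1Curve s c) (hd : IsC1Curve s d) :
    IsC1Curve s fun t => c t + d t := by
  obtain ⟨Γ, hΓ, h⟩ := hc
  obtain ⟨Δ, hΔ, h'⟩ := hd
  refine ⟨fun t => Γ t + Δ t, hΓ.add hΔ, fun t ht n => ?_⟩
  rw [lp.coeFn_add, Pi.add_apply, h t ht, h' t ht]
  simp [bessel]

/-- The weights `(1 + n²)^{±1/4}` cancel: on ℓ² representatives of H^{1/2}, `quarterBessel` is the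
inclusion into L². -/
theorem quarterBessel_eq {c : Series m} {x : SqSummable m} (h : ∀ n, x n = bessel (1 / 2) c n) :
    ⇑(quarterBessel x) = c := by
  funext n
  have h0 : (0 : ℝ) < 1 + (n : ℝ) ^ 2 := by positivity
  rw [← bessel_neg_coe, bessel, h, bessel, smul_smul, ← Real.rpow_add h0]
  norm_num

/-- A `C¹` curve in `H^{1/2}` is a `C¹` curve in `L²`. -/
theorem IsC1Curve.exists_Lp {v : ℝ → Circ → Vec m} (hc : IsC1Curve (1 / 2) fun t => coeff (v t))
    (hv : ∀ t ∈ Ioo (-1 : ℝ) 1, MemLp (v t) 2 haar) :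
    ∃ Γ : ℝ → Lp (Vec m) 2 haar, ContDiffOn ℝ 1 Γ (Ioo (-1) 1) ∧
      ∀ t ∈ Ioo (-1 : ℝ) 1, Γ t =ᵐ[haar] v t := by
  obtain ⟨Γ, hΓ, h⟩ := hc
  refine ⟨fun t => synthesis (quarterBessel (Γ t)),
    (synthesis ∘L quarterBessel).contDiff.comp_contDiffOn hΓ, fun t ht => ?_⟩
  have : quarterBessel (Γ t) = analysis (hv t ht).toLp := by
    ext1
    exact (quarterBessel_eq (h t ht)).trans (coe_coeffLp (hv t ht)).symm
  simp only [this, synthesis_analysis]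
  exact (hv t ht).coeFn_toLp

/-- `(-Δ)₀^{-1/4} d/dθ` maps `C¹` curves in `H^{1/2}` to `C¹` curves in `L²`. -/
theorem IsC1Curve.exists_invFracLap_dtheta {c : ℝ → Series m} (hc : IsC1Curve (1 / 2) c) :
    ∃ B : ℝ → SqSummable m, ContDiffOn ℝ 1 B (Ioo (-1) 1) ∧
      ∀ t ∈ Ioo (-1 : ℝ) 1, invFracLap (1 / 2) (dtheta (c t)) = ⇑(B t) := by
  obtain ⟨Γ, hΓ, h⟩ := hc
  -- The symbol of Λ d/dθ after removal of the H^{1/2} weight; its modulus `|n|^{1/2} (1 +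
  -- n²)^{-1/4}` is at most 1.
  let a : ℤ → ℂ := fun n => if n = 0 then 0 else
    ((|(n : ℝ)| ^ (-(1 / 2) : ℝ) * (1 + (n : ℝ) ^ 2) ^ (-(1 / 2) / 2 : ℝ) : ℝ) : ℂ)
      * (Complex.I * n)
  have ha : ∀ n, ‖a n‖ ≤ 1 := by
    intro n
    simp only [a]
    split_ifs with hn
    · simp
    · have h1 : 0 < |(n : ℝ)| := by positivity
      rw [norm_mul, norm_mul, Complex.norm_I, one_mul, Complex.norm_intCast, Complex.norm_real,
        Real.norm_of_nonneg (by positivity), mul_right_comm]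
      nth_rw 2 [← Real.rpow_one |(n : ℝ)|]
      rw [← Real.rpow_add h1]
      have h2 : (1 + (n : ℝ) ^ 2) ^ (-(1 / 2) / 2 : ℝ)
          ≤ (|(n : ℝ)| ^ (2 : ℝ)) ^ (-(1 / 2) / 2 : ℝ) := by
        refine Real.rpow_le_rpow_of_nonpos (by positivity) ?_ (by norm_num)
        simp
      rw [← Real.rpow_mul h1.le] at h2
      calc _ ≤ |(n : ℝ)| ^ (-(1 / 2) + 1 : ℝ) * |(n : ℝ)| ^ (2 * (-(1 / 2) / 2) : ℝ) := by gcongr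
        _ = 1 := by
          rw [← Real.rpow_add h1]
          norm_num
  refine ⟨fun t => diag a ha (Γ t), (diag a ha).contDiff.comp_contDiffOn hΓ, fun t ht => ?_⟩
  funext n
  rw [← quarterBessel_eq (h t ht), diag_apply, quarterBessel, invFracLap]
  simp only [dtheta, diag_apply, a]
  split_ifs with hn
  · simp
  · ext i
    simp
    ring

theorem IsC1Curve.dtheta {c : ℝ → Series m} (hc : IsC1Curve (1 / 2) c) :
    IsC1Curve (-(1 / 2)) fun t => dtheta (c t) := by
  obtain ⟨Γ, hΓ, h⟩ := hc
  let a : ℤ → ℂ := fun n => (((1 + (n : ℝ) ^ 2) ^ (-(1 / 2) : ℝ) : ℝ) : ℂ) * (Complex.I * n)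
  have ha : ∀ n, ‖a n‖ ≤ 1 := by
    intro n
    have h0 : (0 : ℝ) < 1 + (n : ℝ) ^ 2 := by positivity
    rw [norm_mul, norm_mul, Complex.norm_I, one_mul, Complex.norm_intCast, Complex.norm_real,
      Real.norm_of_nonneg (by positivity), Real.rpow_neg h0.le, ← Real.sqrt_eq_rpow,
      inv_mul_le_one₀ (by positivity)]
    exact Real.abs_le_sqrt (by linarith)
  refine ⟨fun t => diag a ha (Γ t), (diag a ha).contDiff.comp_contDiffOn hΓ, fun t ht n => ?_⟩
  have h0 : (0 : ℝ) < 1 + (n : ℝ) ^ 2 := by positivity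
  rw [diag_apply, h t ht]
  simp only [bessel, HalfHarmonic.dtheta]
  have h3 : (1 + (n : ℝ) ^ 2) ^ (-(1 / 2) / 2 : ℝ)
      = (1 + (n : ℝ) ^ 2) ^ (-(1 / 2) : ℝ) * (1 + (n : ℝ) ^ 2) ^ (1 / 2 / 2 : ℝ) := by
    rw [← Real.rpow_add h0]
    norm_num
  rw [h3]
  ext i
  simp [a]
  ring

theorem exists_fderiv_bound {E W : Type*} [NormedAddCommGroup E] [NormedSpace ℝ E]
    [NormedAddCommGroup W] [NormedSpace ℝ W] {F : E → W} (hF : ContDiff ℝ 1 F)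
    (hs : HasCompactSupport F) : ∃ C, ∀ z, ‖fderiv ℝ F z‖ ≤ C :=
  (hs.fderiv ℝ).exists_bound_of_continuous (hF.continuous_fderiv one_ne_zero)

/-- Superposition with a compactly supported `C¹` map along a `C¹` curve in `H^{1/2}`. -/
theorem IsC1Curve.exists_superposition {v : ℝ → Circ → Vec m} {y : Circ → Vec m}
    (hc : IsC1Curve (1 / 2) fun t => coeff (v t))
    (hv : ∀ t ∈ Ioo (-1 : ℝ) 1, MemLp (v t) 2 haar) (hy : MemLp y 2 haar)
    {F : Vec m × Vec m → Vec m} (hF : ContDiff ℝ 1 F) (hs : HasCompactSupport F) :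
    ∃ X : ℝ → SqSummable m, ContDiffOn ℝ 1 X (Ioo (-1) 1) ∧
      ∀ t ∈ Ioo (-1 : ℝ) 1, coeff (fun θ => F (v t θ, y θ)) = ⇑(X t) := by
  obtain ⟨Γ, hΓ, h⟩ := hc.exists_Lp hv
  obtain ⟨C, hC⟩ := exists_fderiv_bound hF hs
  -- The pair `(v t, y)` as one curve in L² of the product space, with constant second component.
  have hW : ContDiffOn ℝ 1 (fun t =>
      (ContinuousLinearMap.inl ℝ (Vec m) (Vec m)).compLpL 2 haar (Γ t)
      + (ContinuousLinearMap.inr ℝ (Vec m) (Vec m)).compLpL 2 haar hy.toLp) (Ioo (-1) 1) :=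
    (ContinuousLinearMap.contDiff _).comp_contDiffOn hΓ |>.add contDiffOn_const
  refine ⟨fun t => analysis (superposition hF hC _),
    analysis.contDiff.comp_contDiffOn (contDiffOn_superposition hF hC isOpen_Ioo hW),
    fun t ht => ?_⟩
  funext n
  rw [analysis_apply]
  refine congrFun (coeff_congr_ae ?_) n
  symm
  filter_upwards [coeFn_superposition hF hC
      ((ContinuousLinearMap.inl ℝ (Vec m) (Vec m)).compLpL 2 haar (Γ t)
      + (ContinuousLinearMap.inr ℝ (Vec m) (Vec m)).compLpL 2 haar hy.toLp),
    Lp.coeFn_add ((ContinuousLinearMap.inl ℝ (Vec m) (Vec m)).compLpL 2 haar (Γ t))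
      ((ContinuousLinearMap.inr ℝ (Vec m) (Vec m)).compLpL 2 haar hy.toLp),
    (ContinuousLinearMap.inl ℝ (Vec m) (Vec m)).coeFn_compLpL (Γ t),
    (ContinuousLinearMap.inr ℝ (Vec m) (Vec m)).coeFn_compLpL hy.toLp, h t ht, hy.coeFn_toLp]
    with x h1 h2 h3 h4 h5 h6
  rw [h1, h2, Pi.add_apply, h3, h4, h5, h6]
  simp

/-! ### The energy and the Lagrangian on horizontal maps. -/

theorem halfEnergy_eq (v : Circ → Vec m) :
    halfEnergy v = l2Inner (invFracLap (1 / 2) (dtheta (coeff v)))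
      (invFracLap (1 / 2) (dtheta (coeff v))) := by
  rw [halfEnergy, l2Inner, l2Inner]
  congr 2
  funext n
  congr 1
  refine Finset.sum_congr rfl fun i _ => ?_
  rw [Complex.mul_conj, Complex.mul_conj, Complex.normSq_eq_norm_sq, Complex.normSq_eq_norm_sq]
  congr 2
  rcases eq_or_ne n 0 with rfl | hn
  · simp [fracLap, invFracLap]
  · have h1 : 0 < |(n : ℝ)| := by positivity
    simp only [fracLap, invFracLap, if_neg hn, dtheta, PiLp.smul_apply, norm_smul,
      Complex.norm_I, norm_mul, one_mul, Complex.norm_intCast]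
    rw [Real.norm_of_nonneg (by positivity), Real.norm_of_nonneg (by positivity), ← mul_assoc]
    congr 1
    nth_rw 3 [← Real.rpow_one |(n : ℝ)|]
    rw [← Real.rpow_add h1]
    norm_num

variable {PT : Vec m → Matrix (Fin m) (Fin m) ℝ} {v : Circ → Vec m}

theorem IsHorizontal.memLp (hv : IsHorizontal PT v) : MemLp v 2 haar := memLp_haar_iff.2 hv.mem.1

theorem IsHorizontal.tangent_mem (hv : IsHorizontal PT v) : MatMemHHalf fun θ => PT (v θ) := by
  simpa [normalProj] using matMemHHalf_one_sub hv.proj_mem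

theorem IsHorizontal.mulDist_tangent (hPT : IsPlaneDistribution PT) (hv : IsHorizontal PT v) :
    mulDist (fun θ => PT (v θ)) (dtheta (coeff v)) = dtheta (coeff v) := by
  have h := mulDist_one_sub (hPT.isBddField_normal hv.memLp.1)
    (mulSummable_dtheta hv.proj_mem hv.mem.2.2)
  rw [hv.horizontal, sub_zero] at h
  simpa [normalProj] using h

theorem l2Inner_zero_right (f : Series m) : l2Inner f 0 = 0 := by
  simp [l2Inner]

/-- The Lagrangian on a horizontal map with multiplier `du/dθ + h`. -/
theorem lagrangian_of_isHorizontal (hPT : IsPlaneDistribution PT) (hv : IsHorizontal PT v)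
    {h : Circ → Vec m} (hh : MemLp h 2 haar) {B X : SqSummable m}
    (hB : invFracLap (1 / 2) (dtheta (coeff v)) = ⇑B)
    (hX : coeff (mulField (fun θ => PT (v θ)) h) = ⇑X) :
    invFracLap (1 / 2) (mulDist (fun θ => PT (v θ)) (dtheta (coeff v) + coeff h))
        = ⇑(B + quarterInv X) ∧
      lagrangian PT v (dtheta (coeff v) + coeff h)
        = π * ‖quarterInv X‖ ^ 2 - halfEnergy v / 2 := by
  have hP := hPT.isBddField hv.memLp.1
  have h1 : invFracLap (1 / 2) (mulDist (fun θ => PT (v θ)) (dtheta (coeff v) + coeff h))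
        = ⇑(B + quarterInv X) := by
    rw [mulDist_add (mulSummable_dtheta hv.tangent_mem hv.mem.2.2) (mulSummable_coeff hP hh),
      hv.mulDist_tangent hPT, mulDist_coeff hP hh, hX, lp.coeFn_add, ← hB, ← invFracLap_coe]
    funext n
    simp only [invFracLap, Pi.add_apply]
    split_ifs <;> simp
  refine ⟨h1, ?_⟩
  have h0 : invFracLap (1 / 2) (0 : Series m) = 0 := by
    funext n
    simp [invFracLap]
  -- With q = `quarterInv X`, the tangential terms are ½‖B + q‖² - ⟨B + q, B⟩ = ½‖q‖² - ½‖B‖², times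
  -- 2π; the normal term is zero.
  rw [lagrangian, h1, hv.horizontal, hv.mulDist_tangent hPT, hB, h0, l2Inner_zero_right, l2Inner_eq,
    l2Inner_eq, halfEnergy_eq, hB, l2Inner_eq, inner_add_left, inner_add_left, inner_add_right,
    inner_add_right, real_inner_comm (quarterInv X) B, real_inner_self_eq_norm_sq (quarterInv X)]
  ring

theorem isVariationalHalfHarmonic_of_isCriticalPoint (hPT : IsPlaneDistribution PT)
    (hu : IsSmooth u) (hξ : IsSmooth ξ) (hcrit : IsCriticalPoint PT u (coeff ξ)) :
    IsVariationalHalfHarmonic PT u := by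
  have hξ2 := memLp_of_continuous hξ.continuous
  refine ⟨isHorizontal_of_isCriticalPoint hPT hu hξ2 hcrit, fun v hv hc h0 => ?_⟩
  have h00 : (0 : ℝ) ∈ Ioo (-1 : ℝ) 1 := by norm_num
  have h0' : v 0 =ᵐ[haar] u := ae_haar_iff.2 h0
  have hum := hu.continuous.aestronglyMeasurable (μ := haar)
  have hP := hPT.isBddField hum
  have hu' := memLp_of_continuous (continuous_derivCirc hu)
  set y : Circ → Vec m := ξ - derivCirc u with hy_def
  have hyc : Continuous y := hξ.continuous.sub (continuous_derivCirc hu)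
  have hy : MemLp y 2 haar := hξ2.sub hu'
  -- a cutoff which equals one near the range of `(u, y)`
  obtain ⟨R, hR⟩ := isCompact_univ.exists_bound_of_continuousOn
    (f := fun θ => (u θ, y θ)) (hu.continuous.prodMk hyc).continuousOn
  -- The maximum with 0 keeps the radii positive even if the bound `R` is negative.
  let χ : ContDiffBump (0 : Vec m × Vec m) := ⟨max R 0 + 1, max R 0 + 2, by positivity, by linarith⟩
  have hχ1 : ∀ θ, χ (u θ, y θ) = 1 := fun θ => χ.one_of_mem_closedBall <| by
    rw [mem_closedBall_zero_iff]
    exact (hR θ (mem_univ θ)).trans (by linarith [le_max_left R 0])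
  let F : Vec m × Vec m → Vec m := fun p => χ p • p.2
  let G : Vec m × Vec m → Vec m := fun p => χ p • WithLp.toLp 2 (PT p.1 *ᵥ p.2.ofLp)
  have hF : ContDiff ℝ 1 F := χ.contDiff.smul contDiff_snd
  have hG : ContDiff ℝ 1 G := by
    refine χ.contDiff.smul (contDiff_euclidean.2 fun i => ?_)
    simp only [Matrix.mulVec, dotProduct]
    refine ContDiff.sum fun j _ => ((hPT.contDiff i j).comp contDiff_fst).mul ?_
    exact (contDiff_euclidean.1 contDiff_snd) j
  have hv2 : ∀ t ∈ Ioo (-1 : ℝ) 1, MemLp (v t) 2 haar := fun t ht => (hv t ht).memLp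
  obtain ⟨Y, hY, hY'⟩ := hc.exists_superposition hv2 hy hF χ.hasCompactSupport.smul_right
  obtain ⟨X, hX, hX'⟩ := hc.exists_superposition hv2 hy hG χ.hasCompactSupport.smul_right
  obtain ⟨B, hB, hB'⟩ := hc.exists_invFracLap_dtheta
  let h : ℝ → Circ → Vec m := fun t θ => F (v t θ, y θ)
  have hh : ∀ t ∈ Ioo (-1 : ℝ) 1, MemLp (h t) 2 haar := fun t ht => by
    refine MemLp.of_le hy ?_ (.of_forall fun θ => ?_)
    · exact hF.continuous.comp_aestronglyMeasurable ((hv2 t ht).1.prodMk hy.1)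
    · simp only [h, F, norm_smul, Real.norm_of_nonneg χ.nonneg]
      exact mul_le_of_le_one_left (norm_nonneg _) χ.le_one
  have hGF : ∀ t, mulField (fun θ => PT (v t θ)) (h t) = fun θ => G (v t θ, y θ) := fun t => by
    funext θ
    ext i
    simp [mulField, h, F, G, Matrix.mulVec_smul]
  have hlag := fun t ht => lagrangian_of_isHorizontal hPT (hv t ht) (hh t ht) (hB' t ht)
    ((congrArg coeff (hGF t)).trans (hX' t ht))
  have hζ : IsC1Curve (-(1 / 2)) fun t => dtheta (coeff (v t)) + coeff (h t) :=
    hc.dtheta.add (isC1Curve_neg hY hY')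
  have hT : IsC1Curve 0 fun t => invFracLap (1 / 2) (mulDist (fun θ => PT (v t θ))
      (dtheta (coeff (v t)) + coeff (h t))) :=
    isC1Curve_zero (hB.add (quarterInv.contDiff.comp_contDiffOn hX)) fun t ht => (hlag t ht).1
  have hD : IsC1Curve 0 fun t => invFracLap (1 / 2) (mulDist (fun θ => PT (v t θ))
      (dtheta (coeff (v t)))) :=
    isC1Curve_zero hB fun t ht => by rw [(hv t ht).mulDist_tangent hPT, hB' t ht]
  have hreal : ∀ t, IsReal (dtheta (coeff (v t))) := fun t => (isReal_coeff _).dtheta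
  have hcurve : IsC1CurveE PT v fun t => dtheta (coeff (v t)) + coeff (h t) := by
    refine ⟨fun t ht => ⟨(hv t ht).mem, ⟨(hreal t).add (isReal_coeff _), hζ.memℓp ht⟩,
      (hv t ht).tangent_mem, ?_, ⟨?_, hT.memℓp ht⟩, ⟨?_, hD.memℓp ht⟩⟩, hc, hζ, hT, hD⟩
    · rw [pairing, (hv t ht).horizontal]
      simp
    · have hP := hPT.isBddField (hv2 t ht).1
      rw [mulDist_add (mulSummable_dtheta (hv t ht).tangent_mem (hv t ht).mem.2.2)
        (mulSummable_coeff hP (hh t ht)), (hv t ht).mulDist_tangent hPT, mulDist_coeff hP (hh t ht)]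
      exact ((hreal t).add (isReal_coeff _)).invFracLap _
    · rw [(hv t ht).mulDist_tangent hPT]
      exact (hreal t).invFracLap _
  have hζ0 : dtheta (coeff (v 0)) + coeff (h 0) = coeff ξ := by
    have h1 : h 0 =ᵐ[haar] y := by
      filter_upwards [h0'] with θ hθ
      simp [h, F, hθ, hχ1]
    rw [coeff_congr_ae h0', coeff_congr_ae h1, ← coeff_derivCirc hu, ← coeff_add hu' hy, hy_def,
      add_sub_cancel]
  -- At `t = 0` the cutoff is 1, so `X 0` represents P_T(u)(ξ - u'), which Λ annihilates by the
  -- Euler-Lagrange equation.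
  have hX0 : quarterInv (X 0) = 0 := by
    rw [← quarterInvMul_tangent_eq_zero hPT hu hξ2 hP (hPT.isBddField_normal hum) hu' hcrit,
      quarterInvMul]
    congr 1
    ext1
    rw [← hX' 0 h00, coe_coeffLp]
    refine coeff_congr_ae ?_
    filter_upwards [h0'] with θ hθ
    simp only [G, hθ, hχ1, one_smul, mulField]
    rfl
  have hL := hcrit.2 v _ hcurve h0 hζ0
  have hXd : DifferentiableAt ℝ (fun t => quarterInv (X t)) 0 :=
    ((quarterInv.contDiff.comp_contDiffOn hX).differentiableOn one_ne_zero).differentiableAt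
      (isOpen_Ioo.mem_nhds h00)
  -- The energy equals 2π‖q‖² - 2𝓛 with q = `quarterInv (X t)`, and the derivative 2⟨q, q̇⟩ of ‖q‖²
  -- vanishes with q at 0.
  have hN := (hXd.hasDerivAt.norm_sq).const_mul (2 * π)
  have hfinal := hN.sub (hL.const_mul 2)
  rw [hX0] at hfinal
  simp only [inner_zero_left, mul_zero, sub_zero] at hfinal
  refine hfinal.congr_of_eventuallyEq ?_
  filter_upwards [isOpen_Ioo.mem_nhds h00] with t ht
  simp only [Pi.sub_apply, (hlag t ht).2]
  ring

end HalfHarmonic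

end

theorem theorem5p1 (m : ℕ)
    (PT : HalfHarmonic.Vec m → Matrix (Fin m) (Fin m) ℝ)
    (hPT : HalfHarmonic.IsPlaneDistribution PT)
    (u ξ : HalfHarmonic.Circ → HalfHarmonic.Vec m)
    (hu : HalfHarmonic.IsSmooth u) (hξ : HalfHarmonic.IsSmooth ξ)
    (hcrit : HalfHarmonic.IsCriticalPoint PT u (HalfHarmonic.coeff ξ))
    (hnd : HalfHarmonic.IsNondegenerate PT u) :
    HalfHarmonic.IsHorizontal PT u ∧ HalfHarmonic.IsVariationalHalfHarmonic PT u :=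
  have h := HalfHarmonic.isVariationalHalfHarmonic_of_isCriticalPoint hPT hu hξ hcrit
  ⟨h.1, h⟩
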